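/- Conventions. Let $G$ be a finite group. A right action of $G$ on a category $\mathcal D$ consists of auto-equivalences $\rho_g$ ($g\in G$; write $X^g=\rho_g(X)$) and natural isomorphisms $\theta_{g,h}\colon\rho_g\rho_h\to\rho_{hg}$ with $\theta_{g,kh}\circ\rho_g\theta_{h,k}=\theta_{hg,k}\circ\theta_{g,h}\rho_k$. The category $\mathcal D^G$ has as objects the pairs $(X,(\chi_g)_g)$ with isomorphisms $\chi_g\colon X\to X^g$ such that $\theta_{g,h}\circ(\chi_h)^g\circ\chi_g=\chi_{hg}$, and as morphisms the morphisms of $\mathcal D$ commuting with the $\chi_g$. A $G$-functor is a functor $F$ with natural isomorphisms $\sigma_g\colon F\rho_g\to\hat\rho_gF$ such that $\sigma_{hg}\circ F\theta_{g,h}=\hat\theta_{g,h}F\circ\hat\rho_g\sigma_h\circ\sigma_g\rho_h$; it induces $F^G(X,\chi)=(FX,(\sigma_g\circ F\chi_g)_g)$. An action on a triangulated category is admissible if each $\rho_g$ is a triangulated functor and the $\theta_{g,h}$ commute with the shift isomorphisms $\rho_g[1]\cong[1]\rho_g$ (so $[1]$ is a $G$-functor and $[1]^G$ is a shift on $\mathcal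 D^G$). A $G$-functor between triangulated categories with admissible actions is triangulated if $F$ is triangulated and the $\sigma_g$ commute with the shift isomorphisms. A canonical triangulated structure on $\mathcal T^G$ is a triangulated structure with shift $[1]^G$ for which the forgetful functor $\mathcal T^G\to\mathcal T$ is triangulated; $\mathcal T^G$ is canonically triangulated if it has one. $|G|$ is invertible in $\mathcal T$ if every morphism $f$ is of the form $|G|\cdot f'$. A recollement $\mathsf R_{\mathsf{tr}}(\mathcal U,\mathcal T,\mathcal V)$ of triangulated categories consists of triangulated functors forming adjoint triples $(\mathsf q,\mathsf i,\mathsf p)$, with $\mathsf i\colon\mathcal U\to\mathcal T$, and $(\mathsf l,\mathsf e,\mathsf r)$, with $\mathsf e\colon\mathcal T\to\mathcal V$, the adjunctions being compatible with the shifts, such that $\mathsf i,\mathsf l,\mathsf r$ are fully faithful and the essential image of $\mathsf i$ is $\operatorname{Ker}\mathsf e$ (so that $\mathcal V\simeq\mathcal T/\mathcal U$); $\mathcal U$ is identified with this essential image. Theorem. Let $\mathsf R_{\mathsf{tr}}(\mathcal U,\mathcal T,\mathcal V)$ be a recollement of triangulated categories and let the finite group $G$ act admissibly on $\mathcal T$,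 with $|G|$ invertible in $\mathcal T$ and $\mathcal T^G$ canonically triangulated. The following are equivalent: (i) there are an admissible $G$-action on $\mathcal V$ and a structure of triangulated $G$-functor on $\mathsf e$; (i') there are an admissible $G$-action on $\mathcal V$ and a structure of $G$-functor on $\mathsf e$ (not necessarily compatible with the shifts); (ii) $\mathcal U$ is a $G$-invariant triangulated subcategory of $\mathcal T$, i.e. the essential image of $\mathsf i$ is a triangulated subcategory and $X^g$ lies in it for all $g\in G$ and all $X$ in it. If these hold, there is also an admissible $G$-action on $\mathcal U$ for which $\mathsf i$ is a triangulated $G$-functor. Moreover, for all admissible actions on $\mathcal U$ and $\mathcal V$ and all structures of triangulated $G$-functor on $\mathsf i$ and $\mathsf e$, the functors $\mathsf q,\mathsf p,\mathsf l,\mathsf r$ carry structures of triangulated $G$-functors for which the units and counits of the four adjunctions commute with the actions, $\mathcal U^G$ and $\mathcal V^G$ have canonical triangulated structures, and the functors $\mathsf i^G,\mathsf q^G,\mathsf p^G,\mathsf e^G,\mathsf l^G,\mathsf r^G$ form, with the induced adjunctions, a recollement of triangulated categories $\mathsf R_{\mathsf{tr}}(\mathcal U^G,\mathcal T^G,\mathcal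 V^G)$. -/

import Mathlib

open CategoryTheory CategoryTheory.Limits

universe w v₁ v₂ v₃ u₁ u₂ u₃

namespace EquivariantRecollement

noncomputable section

/-! ### Group actions on categories, equivariant objects, `G`-functors -/

/-- A right action `(ρ, θ)` of a group `G` on a category `C`: auto-equivalences `ρ g` and
composition isomorphisms `θ g h : ρ_g ∘ ρ_h ≅ ρ_{hg}` satisfying the 2-cocycle condition
`θ_{g,kh} ∘ ρ_g θ_{h,k} = θ_{hg,k} ∘ θ_{g,h} ρ_k` (the `eqToHom` is the identification
`ρ_{k(hg)} = ρ_{(kh)g}` given by associativity in `G`).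
Note that `F ⋙ H` is `F` followed by `H`. -/
structure RightAction (G : Type w) [Group G] (C : Type u₁) [Category.{v₁} C] where
  ρ : G → C ⥤ C
  isEquivalence : ∀ g, (ρ g).IsEquivalence
  θ : ∀ g h, ρ h ⋙ ρ g ≅ ρ (h * g)
  cocycle : ∀ (g h k : G) (X : C),
    (ρ g).map ((θ h k).hom.app X) ≫ (θ g (k * h)).hom.app X =
      (θ g h).hom.app ((ρ k).obj X) ≫ (θ (h * g) k).hom.app X ≫
        eqToHom (by rw [mul_assoc])

section Basic

variable {G : Type w} [Group G]
  {C : Type u₁} [Category.{v₁} C] {D : Type u₂} [Category.{v₂} D] {E : Type u₃} [Category.{v₃} E]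

/-- `G`-equivariant objects `(X, χ)` of `C`. -/
structure EquivariantObject (A : RightAction G C) where
  obj : C
  χ : ∀ g, obj ≅ (A.ρ g).obj obj
  cocycle : ∀ g h,
    (χ g).hom ≫ (A.ρ g).map (χ h).hom ≫ (A.θ g h).hom.app obj = (χ (h * g)).hom

namespace EquivariantObject

variable {A : RightAction G C}

/-- Morphisms of equivariant objects: the morphisms which commute with the linearizations. -/
@[ext]
structure Hom (X Y : EquivariantObject A) where
  hom : X.obj ⟶ Y.obj
  comm : ∀ g, (X.χ g).hom ≫ (A.ρ g).map hom = hom ≫ (Y.χ g).hom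

/-- The equivariant category `C^G`. -/
instance : Category.{v₁} (EquivariantObject A) where
  Hom X Y := Hom X Y
  id X := { hom := 𝟙 X.obj, comm := by simp }
  comp f g := { hom := f.hom ≫ g.hom
                comm := fun a => by
                  rw [Functor.map_comp, ← Category.assoc, f.comm, Category.assoc, g.comm,
                    Category.assoc] }

@[simp] lemma id_hom (X : EquivariantObject A) : Hom.hom (𝟙 X) = 𝟙 X.obj := rfl

@[simp] lemma comp_hom {X Y Z : EquivariantObject A} (f : X ⟶ Y) (g : Y ⟶ Z) :
    Hom.hom (f ≫ g) = Hom.hom f ≫ Hom.hom g := rfl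

@[ext] lemma hom_ext {X Y : EquivariantObject A} {f g : X ⟶ Y} (h : Hom.hom f = Hom.hom g) :
    f = g := Hom.ext h

lemma eqToHom_hom {X Y : EquivariantObject A} (h : X = Y) :
    Hom.hom (eqToHom h) = eqToHom (congrArg EquivariantObject.obj h) := by
  subst h
  rfl

/-- The forgetful functor `C^G ⥤ C`. -/
@[simps]
def forget (A : RightAction G C) : EquivariantObject A ⥤ C where
  obj X := X.obj
  map f := Hom.hom f

instance : (forget A).Faithful where
  map_injective h := hom_ext h

/-- An isomorphism of underlying objects commuting with the linearizations. -/
@[simps]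
def isoMk {X Y : EquivariantObject A} (e : X.obj ≅ Y.obj)
    (h : ∀ g, (X.χ g).hom ≫ (A.ρ g).map e.hom = e.hom ≫ (Y.χ g).hom) : X ≅ Y where
  hom := { hom := e.hom, comm := h }
  inv := { hom := e.inv
           comm := fun g => by
            rw [← cancel_epi e.hom, ← reassoc_of% (h g), ← Functor.map_comp]
            simp }
  hom_inv_id := by ext; simp
  inv_hom_id := by ext; simp

end EquivariantObject

/-- A `G`-functor structure `σ` on a functor `F : C ⥤ D` between categories with `G`-actions:
natural isomorphisms `σ_g : F ∘ ρ_g ≅ ρ̂_g ∘ F` compatible with the composition isomorphisms. -/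
structure GFunctor (A : RightAction G C) (B : RightAction G D) (F : C ⥤ D) where
  σ : ∀ g, A.ρ g ⋙ F ≅ F ⋙ B.ρ g
  assoc : ∀ (g h : G) (X : C),
    F.map ((A.θ g h).hom.app X) ≫ (σ (h * g)).hom.app X =
      (σ g).hom.app ((A.ρ h).obj X) ≫ (B.ρ g).map ((σ h).hom.app X) ≫
        (B.θ g h).hom.app (F.obj X)

/-- The identity `G`-functor. -/
@[simps]
def GFunctor.id (A : RightAction G C) : GFunctor A A (𝟭 C) where
  σ g := Functor.rightUnitor _ ≪≫ (Functor.leftUnitor _).symm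
  assoc g h X := by simp

/-- The composition of `G`-functors. -/
@[simps]
def GFunctor.comp {A : RightAction G C} {B : RightAction G D} {K : RightAction G E}
    {F : C ⥤ D} {H : D ⥤ E} (s : GFunctor A B F) (t : GFunctor B K H) :
    GFunctor A K (F ⋙ H) where
  σ g := (Functor.associator _ _ _).symm ≪≫ Functor.isoWhiskerRight (s.σ g) H ≪≫
    Functor.associator _ _ _ ≪≫ Functor.isoWhiskerLeft F (t.σ g) ≪≫
    (Functor.associator _ _ _).symm
  assoc g h X := by
    have h₁ := t.assoc g h (F.obj X)
    have h₂ := congrArg H.map (s.assoc g h X)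
    have h₃ := (t.σ g).hom.naturality ((s.σ h).hom.app X)
    simp only [Functor.map_comp, Functor.comp_obj, Functor.comp_map] at h₁ h₂ h₃
    simp only [Functor.comp_obj, Functor.comp_map, Iso.trans_hom, Iso.symm_hom,
      NatTrans.comp_app, Functor.associator_inv_app, Functor.associator_hom_app,
      Functor.isoWhiskerRight_hom, Functor.isoWhiskerLeft_hom, Functor.whiskerRight_app,
      Functor.whiskerLeft_app, Category.id_comp, Category.comp_id, Functor.map_comp,
      Category.assoc]
    rw [reassoc_of% h₂, h₁, reassoc_of% h₃]

/-- `G`-natural transformations between `G`-functors. -/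
def IsGNatural {A : RightAction G C} {B : RightAction G D} {F H : C ⥤ D}
    (s : GFunctor A B F) (t : GFunctor A B H) (η : F ⟶ H) : Prop :=
  ∀ (g : G) (X : C), η.app ((A.ρ g).obj X) ≫ (t.σ g).hom.app X =
    (s.σ g).hom.app X ≫ (B.ρ g).map (η.app X)

/-- The equivariant functor `F^G : C^G ⥤ D^G`, `(X, χ) ↦ (F X, σ ∘ F χ)`, `f ↦ F f`, induced
by a `G`-functor `(F, σ)`. -/
@[simps]
def GFunctor.equivariant {A : RightAction G C} {B : RightAction G D} {F : C ⥤ D}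
    (s : GFunctor A B F) : EquivariantObject A ⥤ EquivariantObject B where
  obj X :=
    { obj := F.obj X.obj
      χ := fun g => F.mapIso (X.χ g) ≪≫ (s.σ g).app X.obj
      cocycle := fun g h => by
        have h₁ := s.assoc g h X.obj
        have h₂ := (s.σ g).hom.naturality (X.χ h).hom
        have h₃ := congrArg F.map (X.cocycle g h)
        simp only [Functor.map_comp, Functor.comp_obj, Functor.comp_map] at h₁ h₂ h₃
        simp only [Iso.trans_hom, Functor.mapIso_hom, Iso.app_hom, Functor.map_comp,
          Category.assoc]
        rw [← reassoc_of% h₂, ← h₁, ← h₃]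
        simp only [Category.assoc] }
  map {X Y} f :=
    { hom := F.map f.hom
      comm := fun g => by
        have h₂ := (s.σ g).hom.naturality f.hom
        have h₃ := congrArg F.map (f.comm g)
        simp only [Functor.map_comp, Functor.comp_obj, Functor.comp_map] at h₂ h₃
        simp only [Iso.trans_hom, Functor.mapIso_hom, Iso.app_hom, Category.assoc]
        rw [← h₂, reassoc_of% h₃] }
  map_id X := by ext; simp
  map_comp f g := by ext; simp

/-- An adjunction between `G`-functors whose unit and counit are `G`-natural induces an adjunction
between the equivariant functors, whose unit and counit have the same underlying morphisms. -/
def equivariantAdjunction {A : RightAction G C} {B : RightAction G D} {F : C ⥤ D} {H : D ⥤ C}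
    (s : GFunctor A B F) (t : GFunctor B A H) (adj : F ⊣ H)
    (hunit : IsGNatural (GFunctor.id A) (s.comp t) adj.unit)
    (hcounit : IsGNatural (t.comp s) (GFunctor.id B) adj.counit) :
    s.equivariant ⊣ t.equivariant where
  unit :=
    { app := fun X =>
        { hom := adj.unit.app X.obj
          comm := fun g => by
            have h₁ : adj.unit.app ((A.ρ g).obj X.obj) ≫ H.map ((s.σ g).hom.app X.obj) ≫
                (t.σ g).hom.app (F.obj X.obj) = (A.ρ g).map (adj.unit.app X.obj) := by
              simpa using hunit g X.obj
            have h₂ : (X.χ g).hom ≫ adj.unit.app ((A.ρ g).obj X.obj) =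
                adj.unit.app X.obj ≫ H.map (F.map (X.χ g).hom) :=
              adj.unit.naturality (X.χ g).hom
            change (X.χ g).hom ≫ (A.ρ g).map (adj.unit.app X.obj) = adj.unit.app X.obj ≫
              H.map (F.map (X.χ g).hom ≫ (s.σ g).hom.app X.obj) ≫ (t.σ g).hom.app (F.obj X.obj)
            rw [← h₁, reassoc_of% h₂, Functor.map_comp, Category.assoc] }
      naturality := fun X Y f => EquivariantObject.hom_ext (adj.unit.naturality f.hom) }
  counit :=
    { app := fun X =>
        { hom := adj.counit.app X.obj
          comm := fun g => by
            have h₁ : adj.counit.app ((B.ρ g).obj X.obj) = F.map ((t.σ g).hom.app X.obj) ≫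
                (s.σ g).hom.app (H.obj X.obj) ≫ (B.ρ g).map (adj.counit.app X.obj) := by
              simpa using hcounit g X.obj
            have h₂ : F.map (H.map (X.χ g).hom) ≫ adj.counit.app ((B.ρ g).obj X.obj) =
                adj.counit.app X.obj ≫ (X.χ g).hom :=
              adj.counit.naturality (X.χ g).hom
            change (F.map (H.map (X.χ g).hom ≫ (t.σ g).hom.app X.obj) ≫
              (s.σ g).hom.app (H.obj X.obj)) ≫ (B.ρ g).map (adj.counit.app X.obj) =
                adj.counit.app X.obj ≫ (X.χ g).hom
            rw [← h₂, h₁, Functor.map_comp, Category.assoc, Category.assoc] }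
      naturality := fun X Y f => EquivariantObject.hom_ext (adj.counit.naturality f.hom) }
  left_triangle_components X :=
    EquivariantObject.hom_ext (adj.left_triangle_components X.obj)
  right_triangle_components X :=
    EquivariantObject.hom_ext (adj.right_triangle_components X.obj)

/-- A full subcategory (given by a property of objects) is `G`-invariant if `C^g` lies in it
for all `C` in it and all `g`. -/
def IsGInvariant (A : RightAction G C) (P : ObjectProperty C) : Prop :=
  ∀ (g : G) (X : C), P X → P ((A.ρ g).obj X)

end Basic

/-- `|G|` is invertible in the preadditive category `C`: every morphism `f` is of the form
`|G| • f'`. -/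
def CardInvertible (G : Type w) (C : Type u₁) [Category.{v₁} C] [Preadditive C] : Prop :=
  ∀ ⦃X Y : C⦄ (f : X ⟶ Y), ∃ f' : X ⟶ Y, f = Nat.card G • f'

/-! ### Admissible actions on triangulated categories -/

section CommShift

variable {C : Type u₁} [Category.{v₁} C] {D : Type u₂} [Category.{v₂} D]
  [HasShift C ℤ] [HasShift D ℤ]

lemma commShift_zero_inv (F : C ⥤ D) [F.CommShift ℤ] (X : C) :
    (F.commShiftIso (0 : ℤ)).inv.app X ≫ F.map ((shiftFunctorZero C ℤ).hom.app X) =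
      (shiftFunctorZero D ℤ).hom.app (F.obj X) := by
  rw [Functor.commShiftIso_zero, Functor.CommShift.isoZero_inv_app, Category.assoc,
    ← Functor.map_comp, Iso.inv_hom_id_app]
  erw [CategoryTheory.Functor.map_id, Category.comp_id]

lemma commShift_add_inv (F : C ⥤ D) [F.CommShift ℤ] (m n : ℤ) (X : C) :
    (F.commShiftIso (m + n)).inv.app X ≫ F.map ((shiftFunctorAdd C m n).hom.app X) =
      (shiftFunctorAdd D m n).hom.app (F.obj X) ≫
        ((F.commShiftIso m).inv.app X)⟦n⟧' ≫ (F.commShiftIso n).inv.app (X⟦m⟧) := by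
  rw [Functor.commShiftIso_add, Functor.CommShift.isoAdd_inv_app]
  simp only [Category.assoc]
  rw [← Functor.map_comp, Iso.inv_hom_id_app]
  erw [CategoryTheory.Functor.map_id, Category.comp_id]

end CommShift

section Triangulated

variable {G : Type w} [Group G]
  {T : Type u₁} [Category.{v₁} T] [HasZeroObject T] [HasShift T ℤ] [Preadditive T]
  [∀ n : ℤ, (shiftFunctor T n).Additive] [Pretriangulated T]
  {V : Type u₂} [Category.{v₂} V] [HasZeroObject V] [HasShift V ℤ] [Preadditive V]
  [∀ n : ℤ, (shiftFunctor V n).Additive] [Pretriangulated V]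

/-- An admissible action on a triangulated category: each `ρ_g` comes with isomorphisms
`ρ_g ∘ [n] ≅ [n] ∘ ρ_g` which make it a triangulated functor, and these isomorphisms are
compatible with the composition isomorphisms `θ`, i.e. they make the shift functors into
`G`-functors. -/
class Admissible (A : RightAction G T) where
  commShift : ∀ g, (A.ρ g).CommShift ℤ
  isTriangulated : ∀ g, (A.ρ g).IsTriangulated
  commShift_θ : ∀ g h, NatTrans.CommShift (A.θ g h).hom ℤ

attribute [reducible] Admissible.commShift

attribute [instance] Admissible.commShift Admissible.isTriangulated Admissible.commShift_θ

/-- A `G`-functor structure on a triangulated functor between triangulated categories with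
admissible actions is triangulated if the isomorphisms `σ_g` are compatible with the shifts. -/
class IsTriangulatedGFunctor {A : RightAction G T} {B : RightAction G V} [Admissible A]
    [Admissible B] {F : T ⥤ V} [F.CommShift ℤ] (s : GFunctor A B F) : Prop where
  commShift_σ : ∀ g, NatTrans.CommShift (s.σ g).hom ℤ

attribute [instance] IsTriangulatedGFunctor.commShift_σ

namespace EquivariantObject

variable {A : RightAction G T} [Admissible A]

section Preadditive

variable (X Y : EquivariantObject A)

instance : Zero (X ⟶ Y) := ⟨{ hom := 0, comm := by simp }⟩

instance : Add (X ⟶ Y) :=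
  ⟨fun f g => { hom := f.hom + g.hom, comm := fun a => by simp [Functor.map_add, f.comm, g.comm] }⟩

instance : Neg (X ⟶ Y) :=
  ⟨fun f => { hom := -f.hom, comm := fun a => by simp [Functor.map_neg, f.comm] }⟩

instance : Sub (X ⟶ Y) :=
  ⟨fun f g => { hom := f.hom - g.hom, comm := fun a => by simp [Functor.map_sub, f.comm, g.comm] }⟩

instance : SMul ℕ (X ⟶ Y) :=
  ⟨fun n f => { hom := n • f.hom, comm := fun a => by simp [f.comm] }⟩

instance : SMul ℤ (X ⟶ Y) :=
  ⟨fun n f => { hom := n • f.hom, comm := fun a => by simp [f.comm] }⟩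

instance : AddCommGroup (X ⟶ Y) :=
  Function.Injective.addCommGroup (fun f : X ⟶ Y => Hom.hom f) (fun _ _ h => hom_ext h)
    rfl (fun _ _ => rfl) (fun _ => rfl) (fun _ _ => rfl) (fun _ _ => rfl) (fun _ _ => rfl)

end Preadditive

/-- `T^G` is preadditive, with the addition of morphisms of `T`. -/
instance : Preadditive (EquivariantObject A) where
  add_comp X Y Z f f' g := by ext; exact Preadditive.add_comp _ _ _ _ _ _
  comp_add X Y Z f g g' := by ext; exact Preadditive.comp_add _ _ _ _ _ _

@[simp] lemma add_hom {X Y : EquivariantObject A} (f g : X ⟶ Y) :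
    Hom.hom (f + g) = Hom.hom f + Hom.hom g := rfl

@[simp] lemma zero_hom {X Y : EquivariantObject A} : Hom.hom (0 : X ⟶ Y) = 0 := rfl

instance : HasZeroObject (EquivariantObject A) := by
  obtain ⟨Z, hZ⟩ := HasZeroObject.zero (C := T)
  let Z' : EquivariantObject A :=
    { obj := Z
      χ := fun g => hZ.iso ((A.ρ g).map_isZero hZ)
      cocycle := fun g h => hZ.eq_of_src _ _ }
  exact ⟨Z', (IsZero.iff_id_eq_zero Z').2 (hom_ext (hZ.eq_of_src _ _))⟩

/-- The object `X⟦n⟧` of `T^G`, with the linearization `X[n] ≅ X^g[n] ≅ X[n]^g`. -/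
@[simps]
def shiftObj (n : ℤ) (X : EquivariantObject A) : EquivariantObject A where
  obj := X.obj⟦n⟧
  χ g := (shiftFunctor T n).mapIso (X.χ g) ≪≫ ((A.ρ g).commShiftIso n).symm.app X.obj
  cocycle g h := by
    have h₁ : (A.θ g h).hom.app (X.obj⟦n⟧) =
        ((A.ρ g).map (((A.ρ h).commShiftIso n).hom.app X.obj) ≫
          ((A.ρ g).commShiftIso n).hom.app ((A.ρ h).obj X.obj)) ≫
        ((A.θ g h).hom.app X.obj)⟦n⟧' ≫ ((A.ρ (h * g)).commShiftIso n).inv.app X.obj := by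
      have := NatTrans.app_shift (A.θ g h).hom n X.obj
      rwa [Functor.commShiftIso_comp_hom_app] at this
    have h₃ : ((A.ρ g).map (X.χ h).hom)⟦n⟧' ≫
        ((A.ρ g).commShiftIso n).inv.app ((A.ρ h).obj X.obj) =
        ((A.ρ g).commShiftIso n).inv.app X.obj ≫ (A.ρ g).map ((X.χ h).hom⟦n⟧') :=
      ((A.ρ g).commShiftIso n).inv.naturality (X.χ h).hom
    have h₄ : (A.ρ g).map (((A.ρ h).commShiftIso n).inv.app X.obj) ≫
        (A.ρ g).map (((A.ρ h).commShiftIso n).hom.app X.obj) = 𝟙 _ := by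
      rw [← Functor.map_comp, Iso.inv_hom_id_app, CategoryTheory.Functor.map_id]
    have h₅ : ((A.ρ g).commShiftIso n).inv.app ((A.ρ h).obj X.obj) ≫
        ((A.ρ g).commShiftIso n).hom.app ((A.ρ h).obj X.obj) = 𝟙 _ :=
      Iso.inv_hom_id_app _ _
    change ((X.χ g).hom⟦n⟧' ≫ ((A.ρ g).commShiftIso n).inv.app X.obj) ≫
      (A.ρ g).map ((X.χ h).hom⟦n⟧' ≫ ((A.ρ h).commShiftIso n).inv.app X.obj) ≫
        (A.θ g h).hom.app (X.obj⟦n⟧) =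
      (X.χ (h * g)).hom⟦n⟧' ≫ ((A.ρ (h * g)).commShiftIso n).inv.app X.obj
    rw [← X.cocycle g h, h₁]
    simp only [Functor.map_comp, Category.assoc]
    rw [reassoc_of% h₄, ← reassoc_of% h₃, reassoc_of% h₅]

/-- The shift `[n]^G` of `T^G`, induced by the `G`-functor `[n]`. -/
@[simps]
def shift (A : RightAction G T) [Admissible A] (n : ℤ) :
    EquivariantObject A ⥤ EquivariantObject A where
  obj X := shiftObj n X
  map {X Y} f :=
    { hom := f.hom⟦n⟧'
      comm := fun g => by
        have h₁ : ((A.ρ g).map f.hom)⟦n⟧' ≫ ((A.ρ g).commShiftIso n).inv.app Y.obj =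
            ((A.ρ g).commShiftIso n).inv.app X.obj ≫ (A.ρ g).map (f.hom⟦n⟧') :=
          ((A.ρ g).commShiftIso n).inv.naturality f.hom
        change ((X.χ g).hom⟦n⟧' ≫ ((A.ρ g).commShiftIso n).inv.app X.obj) ≫
          (A.ρ g).map (f.hom⟦n⟧') =
          f.hom⟦n⟧' ≫ (Y.χ g).hom⟦n⟧' ≫ ((A.ρ g).commShiftIso n).inv.app Y.obj
        rw [← Functor.map_comp_assoc, ← f.comm, Category.assoc, ← h₁,
          Functor.map_comp, Category.assoc] }
  map_id X := hom_ext (CategoryTheory.Functor.map_id _ _)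
  map_comp f g := hom_ext (Functor.map_comp _ _ _)

instance : HasShift (EquivariantObject A) ℤ :=
  hasShiftMk _ _
    { F := shift A
      zero := NatIso.ofComponents
        (fun X => isoMk ((shiftFunctorZero T ℤ).app X.obj) (fun g => by
          change ((X.χ g).hom⟦(0 : ℤ)⟧' ≫ ((A.ρ g).commShiftIso (0 : ℤ)).inv.app X.obj) ≫
            (A.ρ g).map ((shiftFunctorZero T ℤ).hom.app X.obj) =
            (shiftFunctorZero T ℤ).hom.app X.obj ≫ (X.χ g).hom
          rw [Category.assoc, commShift_zero_inv]
          exact (shiftFunctorZero T ℤ).hom.naturality (X.χ g).hom))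
        (fun f => hom_ext ((shiftFunctorZero T ℤ).hom.naturality f.hom))
      add := fun m n => NatIso.ofComponents
        (fun X => isoMk ((shiftFunctorAdd T m n).app X.obj) (fun g => by
          have h₁ : (X.χ g).hom⟦m + n⟧' ≫ (shiftFunctorAdd T m n).hom.app ((A.ρ g).obj X.obj) =
              (shiftFunctorAdd T m n).hom.app X.obj ≫ (X.χ g).hom⟦m⟧'⟦n⟧' :=
            (shiftFunctorAdd T m n).hom.naturality (X.χ g).hom
          change ((X.χ g).hom⟦m + n⟧' ≫ ((A.ρ g).commShiftIso (m + n)).inv.app X.obj) ≫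
            (A.ρ g).map ((shiftFunctorAdd T m n).hom.app X.obj) =
            (shiftFunctorAdd T m n).hom.app X.obj ≫
              ((X.χ g).hom⟦m⟧' ≫ ((A.ρ g).commShiftIso m).inv.app X.obj)⟦n⟧' ≫
              ((A.ρ g).commShiftIso n).inv.app (X.obj⟦m⟧)
          rw [Category.assoc, commShift_add_inv, reassoc_of% h₁, Functor.map_comp,
            Category.assoc]))
        (fun f => hom_ext ((shiftFunctorAdd T m n).hom.naturality f.hom))
      assoc_hom_app := fun m₁ m₂ m₃ X => hom_ext (by
        have h₁ := shiftFunctorAdd_assoc_hom_app m₁ m₂ m₃ X.obj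
        simp only [shiftFunctorAdd', Iso.trans_hom, NatTrans.comp_app, eqToIso.hom, eqToHom_app,
          Category.assoc] at h₁
        simp only [comp_hom, eqToHom_hom]
        exact h₁)
      zero_add_hom_app := fun n X => hom_ext (by
        have h₁ := shiftFunctorAdd_zero_add_hom_app n X.obj
        simp only [comp_hom, eqToHom_hom]
        exact h₁)
      add_zero_hom_app := fun n X => hom_ext (by
        have h₁ := shiftFunctorAdd_add_zero_hom_app n X.obj
        simp only [comp_hom, eqToHom_hom]
        exact h₁) }

instance (n : ℤ) : (shiftFunctor (EquivariantObject A) n).Additive where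
  map_add {_ _ f g} := hom_ext ((shiftFunctor T n).map_add (f := f.hom) (g := g.hom))

/-- The equality `For ∘ [n]^G = [n] ∘ For`. -/
instance : (forget A).CommShift ℤ where
  commShiftIso n := NatIso.ofComponents (fun X => Iso.refl (X.obj⟦n⟧)) (fun f => by
    exact (Category.comp_id _).trans (Category.id_comp _).symm)
  commShiftIso_zero := by
    ext X
    rw [Functor.CommShift.isoZero_hom_app]
    exact ((shiftFunctorZero T ℤ).hom_inv_id_app X.obj).symm
  commShiftIso_add m n := by
    ext X
    rw [Functor.CommShift.isoAdd_hom_app]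
    change 𝟙 _ = (shiftFunctorAdd T m n).hom.app X.obj ≫ 𝟙 _ ≫ (𝟙 (X.obj⟦m⟧))⟦n⟧' ≫
      (shiftFunctorAdd T m n).inv.app X.obj
    rw [CategoryTheory.Functor.map_id]
    erw [Category.id_comp, Category.id_comp]
    exact ((shiftFunctorAdd T m n).hom_inv_id_app X.obj).symm

end EquivariantObject

open EquivariantObject

/-- The equivariant functor `F^G` of a triangulated `G`-functor commutes with the shifts, via the
isomorphisms `F ∘ [n] ≅ [n] ∘ F`. -/
instance GFunctor.equivariantCommShift {A : RightAction G T} {B : RightAction G V} [Admissible A]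
    [Admissible B] {F : T ⥤ V} [F.CommShift ℤ] (s : GFunctor A B F)
    [IsTriangulatedGFunctor s] : s.equivariant.CommShift ℤ where
  commShiftIso n := NatIso.ofComponents
    (fun X => isoMk ((F.commShiftIso n).app X.obj) (fun g => by
      have h₁ : (s.σ g).hom.app (X.obj⟦n⟧) =
          (F.map (((A.ρ g).commShiftIso n).hom.app X.obj) ≫
            (F.commShiftIso n).hom.app ((A.ρ g).obj X.obj)) ≫
          ((s.σ g).hom.app X.obj)⟦n⟧' ≫
            ((B.ρ g).commShiftIso n).inv.app (F.obj X.obj) ≫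
              (B.ρ g).map ((F.commShiftIso n).inv.app X.obj) := by
        have := NatTrans.app_shift (s.σ g).hom n X.obj
        rwa [Functor.commShiftIso_comp_hom_app, Functor.commShiftIso_comp_inv_app] at this
      have h₂ : F.map ((X.χ g).hom⟦n⟧') ≫ (F.commShiftIso n).hom.app ((A.ρ g).obj X.obj) =
          (F.commShiftIso n).hom.app X.obj ≫ (F.map (X.χ g).hom)⟦n⟧' :=
        (F.commShiftIso n).hom.naturality (X.χ g).hom
      have h₃ : F.map (((A.ρ g).commShiftIso n).inv.app X.obj) ≫
          F.map (((A.ρ g).commShiftIso n).hom.app X.obj) = 𝟙 _ := by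
        rw [← Functor.map_comp, Iso.inv_hom_id_app, CategoryTheory.Functor.map_id]
      have h₄ : (B.ρ g).map ((F.commShiftIso n).inv.app X.obj) ≫
          (B.ρ g).map ((F.commShiftIso n).hom.app X.obj) = 𝟙 _ := by
        rw [← Functor.map_comp, Iso.inv_hom_id_app, CategoryTheory.Functor.map_id]
      change (F.map ((X.χ g).hom⟦n⟧' ≫ ((A.ρ g).commShiftIso n).inv.app X.obj) ≫
        (s.σ g).hom.app (X.obj⟦n⟧)) ≫ (B.ρ g).map ((F.commShiftIso n).hom.app X.obj) =
        (F.commShiftIso n).hom.app X.obj ≫ (F.map (X.χ g).hom ≫ (s.σ g).hom.app X.obj)⟦n⟧' ≫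
          ((B.ρ g).commShiftIso n).inv.app (F.obj X.obj)
      rw [h₁]
      simp only [Functor.map_comp, Category.assoc]
      rw [reassoc_of% h₃, reassoc_of% h₂, h₄]
      erw [Category.comp_id]))
    (fun f => hom_ext ((F.commShiftIso n).hom.naturality f.hom))
  commShiftIso_zero := by
    ext X
    rw [Functor.CommShift.isoZero_hom_app]
    have := congr_app (congrArg Iso.hom (F.commShiftIso_zero ℤ)) X.obj
    rw [Functor.CommShift.isoZero_hom_app] at this
    exact this
  commShiftIso_add m n := by
    ext X
    rw [Functor.CommShift.isoAdd_hom_app]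
    have := congr_app (congrArg Iso.hom (F.commShiftIso_add m n)) X.obj
    rw [Functor.CommShift.isoAdd_hom_app] at this
    exact this

/-- A canonical triangulated structure on `T^G`: a triangulated structure (including the octahedral
axiom), with respect to the shift `[1]^G`, for which the forgetful functor is triangulated. -/
structure CanonicalTriangulation (A : RightAction G T) [Admissible A] where
  pretriangulated : Pretriangulated (EquivariantObject A)
  isTriangulated : IsTriangulated (EquivariantObject A)
  forget_isTriangulated : (forget A).IsTriangulated

end Triangulated

/-! ### Recollements of triangulated categories -/

section Recollement

variable (U : Type u₁) [Category.{v₁} U] [HasShift U ℤ]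
  (T : Type u₂) [Category.{v₂} T] [HasShift T ℤ]
  (V : Type u₃) [Category.{v₃} V] [HasShift V ℤ]

/-- The diagram of functors underlying a recollement: adjoint triples `(q, i, p)` between `U` and
`T` and `(l, e, r)` between `T` and `V`, all functors commuting with the shifts. -/
structure RecollementDiagram where
  i : U ⥤ T
  q : T ⥤ U
  p : T ⥤ U
  e : T ⥤ V
  l : V ⥤ T
  r : V ⥤ T
  adj_qi : q ⊣ i
  adj_ip : i ⊣ p
  adj_le : l ⊣ e
  adj_er : e ⊣ r
  commShift_i : i.CommShift ℤ
  commShift_q : q.CommShift ℤ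
  commShift_p : p.CommShift ℤ
  commShift_e : e.CommShift ℤ
  commShift_l : l.CommShift ℤ
  commShift_r : r.CommShift ℤ

attribute [instance] RecollementDiagram.commShift_i RecollementDiagram.commShift_q
  RecollementDiagram.commShift_p RecollementDiagram.commShift_e RecollementDiagram.commShift_l
  RecollementDiagram.commShift_r

variable {U T V}
variable [HasZeroObject U] [Preadditive U] [∀ n : ℤ, (shiftFunctor U n).Additive]
  [HasZeroObject T] [Preadditive T] [∀ n : ℤ, (shiftFunctor T n).Additive]
  [HasZeroObject V] [Preadditive V] [∀ n : ℤ, (shiftFunctor V n).Additive]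

/-- A recollement of triangulated categories: the six functors are triangulated, the adjunctions
are compatible with the shifts, `i`, `l`, `r` are fully faithful and `Im i = Ker e`. -/
structure RecollementDiagram.IsRecollement [Pretriangulated U] [Pretriangulated T]
    [Pretriangulated V] (R : RecollementDiagram U T V) : Prop where
  isTriangulated_i : R.i.IsTriangulated
  isTriangulated_q : R.q.IsTriangulated
  isTriangulated_p : R.p.IsTriangulated
  isTriangulated_e : R.e.IsTriangulated
  isTriangulated_l : R.l.IsTriangulated
  isTriangulated_r : R.r.IsTriangulated
  commShift_qi : R.adj_qi.CommShift ℤ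
  commShift_ip : R.adj_ip.CommShift ℤ
  commShift_le : R.adj_le.CommShift ℤ
  commShift_er : R.adj_er.CommShift ℤ
  full_i : R.i.Full
  faithful_i : R.i.Faithful
  full_l : R.l.Full
  faithful_l : R.l.Faithful
  full_r : R.r.Full
  faithful_r : R.r.Faithful
  essImage_i_iff : ∀ X : T, R.i.essImage X ↔ IsZero (R.e.obj X)

variable [Pretriangulated U] [Pretriangulated T] [Pretriangulated V] {G : Type w} [Group G]

/-- Triangulated `G`-functor structures on the six functors of a recollement, such that the units
and counits of the four adjunctions are `G`-natural. -/
structure RecollementDiagram.GStructure (R : RecollementDiagram U T V)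
    (AU : RightAction G U) (AT : RightAction G T) (AV : RightAction G V)
    [Admissible AU] [Admissible AT] [Admissible AV] where
  i : GFunctor AU AT R.i
  q : GFunctor AT AU R.q
  p : GFunctor AT AU R.p
  e : GFunctor AT AV R.e
  l : GFunctor AV AT R.l
  r : GFunctor AV AT R.r
  isTriangulated_i : IsTriangulatedGFunctor i
  isTriangulated_q : IsTriangulatedGFunctor q
  isTriangulated_p : IsTriangulatedGFunctor p
  isTriangulated_e : IsTriangulatedGFunctor e
  isTriangulated_l : IsTriangulatedGFunctor l
  isTriangulated_r : IsTriangulatedGFunctor r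
  unit_qi : IsGNatural (GFunctor.id AT) (q.comp i) R.adj_qi.unit
  counit_qi : IsGNatural (i.comp q) (GFunctor.id AU) R.adj_qi.counit
  unit_ip : IsGNatural (GFunctor.id AU) (i.comp p) R.adj_ip.unit
  counit_ip : IsGNatural (p.comp i) (GFunctor.id AT) R.adj_ip.counit
  unit_le : IsGNatural (GFunctor.id AV) (l.comp e) R.adj_le.unit
  counit_le : IsGNatural (e.comp l) (GFunctor.id AT) R.adj_le.counit
  unit_er : IsGNatural (GFunctor.id AT) (e.comp r) R.adj_er.unit
  counit_er : IsGNatural (r.comp e) (GFunctor.id AV) R.adj_er.counit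

attribute [instance] RecollementDiagram.GStructure.isTriangulated_i
  RecollementDiagram.GStructure.isTriangulated_q RecollementDiagram.GStructure.isTriangulated_p
  RecollementDiagram.GStructure.isTriangulated_e RecollementDiagram.GStructure.isTriangulated_l
  RecollementDiagram.GStructure.isTriangulated_r

/-- The diagram `(U^G, T^G, V^G)` with the functors `i^G, q^G, p^G, e^G, l^G, r^G`. -/
def RecollementDiagram.equivariant (R : RecollementDiagram U T V)
    {AU : RightAction G U} {AT : RightAction G T} {AV : RightAction G V}
    [Admissible AU] [Admissible AT] [Admissible AV] (S : R.GStructure AU AT AV) :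
    RecollementDiagram (EquivariantObject AU) (EquivariantObject AT) (EquivariantObject AV) where
  i := S.i.equivariant
  q := S.q.equivariant
  p := S.p.equivariant
  e := S.e.equivariant
  l := S.l.equivariant
  r := S.r.equivariant
  adj_qi := equivariantAdjunction S.q S.i R.adj_qi S.unit_qi S.counit_qi
  adj_ip := equivariantAdjunction S.i S.p R.adj_ip S.unit_ip S.counit_ip
  adj_le := equivariantAdjunction S.l S.e R.adj_le S.unit_le S.counit_le
  adj_er := equivariantAdjunction S.e S.r R.adj_er S.unit_er S.counit_er
  commShift_i := inferInstance
  commShift_q := inferInstance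
  commShift_p := inferInstance
  commShift_e := inferInstance
  commShift_l := inferInstance
  commShift_r := inferInstance

/-- `(U^G, T^G, V^G)` is a recollement of triangulated categories, for given canonical
triangulated structures on the equivariant categories. -/
def RecollementDiagram.IsEquivariantRecollement (R : RecollementDiagram U T V)
    {AU : RightAction G U} {AT : RightAction G T} {AV : RightAction G V}
    [Admissible AU] [Admissible AT] [Admissible AV] (S : R.GStructure AU AT AV)
    (PU : CanonicalTriangulation AU) (PT : CanonicalTriangulation AT)
    (PV : CanonicalTriangulation AV) : Prop :=
  letI := PU.pretriangulated
  letI := PT.pretriangulated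
  letI := PV.pretriangulated
  (R.equivariant S).IsRecollement

end Recollement

end

end EquivariantRecollement

open EquivariantRecollement

/-! Two principles carry the proof: equivariant structure passes to adjoints, and it passes along
localizations and fully faithful functors.

Adjoints. If `F ⊣ H` and `F` is a `G`-functor, the mates of the isomorphisms `σ_g` are invertible
because the `ρ_g` are equivalences. They make `H` a `G`-functor with `G`-natural unit and counit
(`GFunctor.rightAdjoint`; dually `GFunctor.leftAdjoint`). Mates are built from units, counits and
`σ`, so shift compatibility is inherited. Structures on `i` and `e` thus determine structures on
`q`, `p`, `l`, `r`, and all four adjunctions lift to the equivariant categories.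

Existence of actions. A `G`-functor `e` has a `G`-invariant kernel, and this kernel is `U`.
Conversely, if `U` is invariant, the cone of `X ⟶ r e X` lies in `U` and stays there under `ρ_g`.
Hence `e ρ_g` inverts this unit, and `e ρ_g r` is the induced functor on `V` (`isIso_map_unit`).
Since `e` is a localization, precomposition with it is fully faithful, so `θ` and its cocycle
identity descend to `V`. On `U` the functors `q ρ_g i` serve in the same way, full faithfulness of
`i` transporting the coherence.

Equivariant recollement. The functors `q^G` and `e^G` have fully faithful right adjoints `i^G` and
`r^G`, hence are localizations of `T^G`. The inverted morphisms are compatible with triangles, which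
can be tested after forgetting the linearizations, so `U^G` and `V^G` receive triangulated
structures (`exists_canonicalTriangulation`). The other four functors are triangulated as adjoints
of triangulated functors. Full faithfulness and the equality of image and kernel are checked on
underlying objects. -/

namespace EquivariantRecollement

noncomputable section

/-! ### Mates under an adjunction -/

section Mates

variable {C : Type u₁} [Category.{v₁} C] {D : Type u₂} [Category.{v₂} D]
  {F : C ⥤ D} {H : D ⥤ C} (adj : F ⊣ H) {P : C ⥤ C} {Q : D ⥤ D}

/-- The mate `H ⋙ P ⟶ Q ⋙ H` of `P ⋙ F ⟶ F ⋙ Q` under an adjunction `F ⊣ H`. -/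
def rightMate (σ : P ⋙ F ⟶ F ⋙ Q) : H ⋙ P ⟶ Q ⋙ H :=
  (Functor.rightUnitor _).inv ≫ Functor.whiskerLeft (H ⋙ P) adj.unit ≫
    (Functor.associator H P (F ⋙ H)).hom ≫
    Functor.whiskerLeft H ((Functor.associator P F H).inv ≫ Functor.whiskerRight σ H ≫
      (Functor.associator F Q H).hom) ≫
    (Functor.associator H F (Q ⋙ H)).inv ≫ Functor.whiskerRight adj.counit (Q ⋙ H) ≫
    (Functor.leftUnitor _).hom

/-- The mate `P ⋙ F ⟶ F ⋙ Q` of `H ⋙ P ⟶ Q ⋙ H` under an adjunction `F ⊣ H`. -/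
def leftMate (τ : H ⋙ P ⟶ Q ⋙ H) : P ⋙ F ⟶ F ⋙ Q :=
  (Functor.leftUnitor _).inv ≫ Functor.whiskerRight adj.unit (P ⋙ F) ≫
    (Functor.associator F H (P ⋙ F)).hom ≫
    Functor.whiskerLeft F ((Functor.associator H P F).inv ≫ Functor.whiskerRight τ F ≫
      (Functor.associator Q H F).hom) ≫
    (Functor.associator F Q (H ⋙ F)).inv ≫ Functor.whiskerLeft (F ⋙ Q) adj.counit ≫
    (Functor.rightUnitor _).hom

lemma rightMate_app (σ : P ⋙ F ⟶ F ⋙ Q) (Y : D) :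
    (rightMate adj σ).app Y = adj.unit.app (P.obj (H.obj Y)) ≫
      H.map (σ.app (H.obj Y)) ≫ H.map (Q.map (adj.counit.app Y)) := by
  simp [rightMate]

lemma leftMate_app (τ : H ⋙ P ⟶ Q ⋙ H) (X : C) :
    (leftMate adj τ).app X = F.map (P.map (adj.unit.app X)) ≫
      F.map (τ.app (F.obj X)) ≫ adj.counit.app (Q.obj (F.obj X)) := by
  simp [leftMate]

/-- This identity characterizes the mate by its transpose. Together with `hom_ext_of_map_counit` it
replaces the explicit formula in later computations. -/
lemma map_rightMate_counit (σ : P ⋙ F ⟶ F ⋙ Q) (Y : D) :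
    F.map ((rightMate adj σ).app Y) ≫ adj.counit.app (Q.obj Y) =
      σ.app (H.obj Y) ≫ Q.map (adj.counit.app Y) := by
  simp [rightMate_app]

lemma unit_map_leftMate (τ : H ⋙ P ⟶ Q ⋙ H) (X : C) :
    adj.unit.app (P.obj X) ≫ H.map ((leftMate adj τ).app X) =
      P.map (adj.unit.app X) ≫ τ.app (F.obj X) := by
  simp [leftMate_app]

lemma hom_ext_of_map_counit {X : C} {Y : D} {f g : X ⟶ H.obj Y}
    (h : F.map f ≫ adj.counit.app Y = F.map g ≫ adj.counit.app Y) : f = g :=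
  (adj.homEquiv X Y).symm.injective (by simpa [Adjunction.homEquiv_counit] using h)

lemma hom_ext_of_unit_map {X : C} {Y : D} {f g : F.obj X ⟶ Y}
    (h : adj.unit.app X ≫ H.map f = adj.unit.app X ≫ H.map g) : f = g :=
  (adj.homEquiv X Y).injective (by simpa [Adjunction.homEquiv_unit] using h)

lemma unit_map_rightMate (σ : P ⋙ F ⟶ F ⋙ Q) (X : C) :
    P.map (adj.unit.app X) ≫ (rightMate adj σ).app (F.obj X) =
      adj.unit.app (P.obj X) ≫ H.map (σ.app X) := by
  have h := σ.naturality (adj.unit.app X)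
  simp only [Functor.comp_map] at h
  apply hom_ext_of_map_counit adj
  rw [Functor.map_comp, Category.assoc, map_rightMate_counit]
  erw [reassoc_of% h]
  simp [← Q.map_comp]

lemma leftMate_counit (τ : H ⋙ P ⟶ Q ⋙ H) (Y : D) :
    (leftMate adj τ).app (H.obj Y) ≫ Q.map (adj.counit.app Y) =
      F.map (τ.app Y) ≫ adj.counit.app (Q.obj Y) := by
  have h := τ.naturality (adj.counit.app Y)
  simp only [Functor.comp_map] at h
  apply hom_ext_of_unit_map adj
  rw [Functor.map_comp, ← Category.assoc, unit_map_leftMate, Category.assoc]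
  erw [← h]
  simp [← Functor.map_comp_assoc]

/-- Yoneda, with test objects restricted to the image of `P`: every object is isomorphic to one of
these. -/
lemma isIso_of_bijective_of_essSurj [P.EssSurj] {X Y : C} (f : X ⟶ Y)
    (h : ∀ Z : C, Function.Bijective fun x : P.obj Z ⟶ X => x ≫ f) : IsIso f := by
  refine isIso_of_yoneda_map_bijective f fun T => ?_
  let e := P.objObjPreimageIso T
  refine ⟨fun a b hab => ?_, fun y => ?_⟩
  · rw [← cancel_epi e.hom]
    exact (h _).1 (by simpa using e.hom ≫= hab)
  · obtain ⟨x, hx⟩ := (h _).2 (e.hom ≫ y)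
    exact ⟨e.inv ≫ x, by simp [show x ≫ f = _ from hx]⟩

lemma isIso_of_bijective_of_essSurj' [P.EssSurj] {X Y : C} (f : X ⟶ Y)
    (h : ∀ Z : C, Function.Bijective fun x : Y ⟶ P.obj Z => f ≫ x) : IsIso f := by
  refine isIso_of_coyoneda_map_bijective f fun T => ?_
  let e := P.objObjPreimageIso T
  refine ⟨fun a b hab => ?_, fun y => ?_⟩
  · rw [← cancel_mono e.inv]
    exact (h _).1 (by simpa using hab =≫ e.inv)
  · obtain ⟨x, hx⟩ := (h _).2 (y ≫ e.inv)
    exact ⟨x ≫ e.hom, by simp [reassoc_of% (show f ≫ x = _ from hx)]⟩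

/-- The mate of an isomorphism `P ⋙ F ≅ F ⋙ Q` is an isomorphism if `P` and `Q` are
equivalences. -/
lemma isIso_rightMate [P.IsEquivalence] [Q.IsEquivalence] (σ : P ⋙ F ≅ F ⋙ Q) :
    IsIso (rightMate adj σ.hom) := by
  suffices ∀ Y, IsIso ((rightMate adj σ.hom).app Y) from NatIso.isIso_of_isIso_app _
  intro Y
  refine isIso_of_bijective_of_essSurj (P := P) _ fun Z => ?_
  -- Postcomposition with the mate is the chain `Hom(PZ, PHY) ≃ Hom(Z, HY) ≃ Hom(FZ, Y) ≃ Hom(QFZ,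
  -- QY) ≃ Hom(FPZ, QY) ≃ Hom(PZ, HQY)`. Full faithfulness of `P` and `Q`, the adjunction and `σ`
  -- supply the bijections.
  let ψ : (P.obj Z ⟶ P.obj (H.obj Y)) ≃ (P.obj Z ⟶ H.obj (Q.obj Y)) :=
    (Functor.FullyFaithful.ofFullyFaithful P).homEquiv.symm.trans <|
      (adj.homEquiv Z Y).symm.trans <|
        (Functor.FullyFaithful.ofFullyFaithful Q).homEquiv.trans <|
          ((σ.app Z).homCongr (Iso.refl _)).symm.trans <| adj.homEquiv _ _
  suffices h : (fun x => x ≫ (rightMate adj σ.hom).app Y) = ψ from h ▸ ψ.bijective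
  funext x
  obtain ⟨b, rfl⟩ := P.map_surjective x
  apply hom_ext_of_map_counit adj
  have h := σ.hom.naturality b
  simp only [Functor.comp_map] at h
  rw [Functor.map_comp, Category.assoc]
  erw [map_rightMate_counit]
  rw [reassoc_of% h]
  simp [ψ, Adjunction.homEquiv_unit, Adjunction.homEquiv_counit, Functor.FullyFaithful.homEquiv]

/-- The mate of an isomorphism `H ⋙ P ≅ Q ⋙ H` is an isomorphism if `P` and `Q` are
equivalences. -/
lemma isIso_leftMate [P.IsEquivalence] [Q.IsEquivalence] (τ : H ⋙ P ≅ Q ⋙ H) :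
    IsIso (leftMate adj τ.hom) := by
  suffices ∀ X, IsIso ((leftMate adj τ.hom).app X) from NatIso.isIso_of_isIso_app _
  intro X
  refine isIso_of_bijective_of_essSurj' (P := Q) _ fun Z => ?_
  -- The dual chain: `Hom(QFX, QZ) ≃ Hom(FX, Z) ≃ Hom(X, HZ) ≃ Hom(PX, PHZ) ≃ Hom(PX, HQZ) ≃
  -- Hom(FPX, QZ)`.
  let ψ : (Q.obj (F.obj X) ⟶ Q.obj Z) ≃ (F.obj (P.obj X) ⟶ Q.obj Z) :=
    (Functor.FullyFaithful.ofFullyFaithful Q).homEquiv.symm.trans <|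
      (adj.homEquiv X Z).trans <|
        (Functor.FullyFaithful.ofFullyFaithful P).homEquiv.trans <|
          ((Iso.refl _).homCongr (τ.app Z)).trans <| (adj.homEquiv _ _).symm
  suffices h : (fun x => (leftMate adj τ.hom).app X ≫ x) = ψ from h ▸ ψ.bijective
  funext x
  obtain ⟨b, rfl⟩ := Q.map_surjective x
  apply hom_ext_of_unit_map adj
  have h := τ.hom.naturality b
  simp only [Functor.comp_map] at h
  rw [Functor.map_comp, ← Category.assoc]
  erw [unit_map_leftMate]
  rw [Category.assoc, ← h]
  simp [ψ, Adjunction.homEquiv_unit, Adjunction.homEquiv_counit, Functor.FullyFaithful.homEquiv]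

section

variable [HasShift C ℤ] [HasShift D ℤ] [F.CommShift ℤ] [H.CommShift ℤ] [P.CommShift ℤ]
  [Q.CommShift ℤ] [adj.CommShift ℤ]

instance (σ : P ⋙ F ⟶ F ⋙ Q) [NatTrans.CommShift σ ℤ] :
    NatTrans.CommShift (rightMate adj σ) ℤ := by
  unfold rightMate
  infer_instance

instance (τ : H ⋙ P ⟶ Q ⋙ H) [NatTrans.CommShift τ ℤ] :
    NatTrans.CommShift (leftMate adj τ) ℤ := by
  unfold leftMate
  infer_instance

end

end Mates

/-! ### Adjoints of `G`-functors, and full faithfulness of equivariant functors -/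

section Adjoints

variable {G : Type w} [Group G]
  {C : Type u₁} [Category.{v₁} C] {D : Type u₂} [Category.{v₂} D]
  {A : RightAction G C} {B : RightAction G D} {F : C ⥤ D} {H : D ⥤ C}

attribute [instance] RightAction.isEquivalence

instance (s : GFunctor A B F) (adj : F ⊣ H) (g : G) : IsIso (rightMate adj (s.σ g).hom) :=
  isIso_rightMate adj (s.σ g)

instance (t : GFunctor B A H) (adj : F ⊣ H) (g : G) : IsIso (leftMate adj (t.σ g).inv) :=
  isIso_leftMate adj (t.σ g).symm

/-- The right adjoint of a `G`-functor is a `G`-functor. -/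
def GFunctor.rightAdjoint (s : GFunctor A B F) (adj : F ⊣ H) : GFunctor B A H where
  σ g := (asIso (rightMate adj (s.σ g).hom)).symm
  assoc g h Y := by
    -- The mates point opposite to the structure isomorphisms of `H`. Coherence is proved for the
    -- mates by transposition, then inverted.
    have key : (A.ρ g).map ((rightMate adj (s.σ h).hom).app Y) ≫
        (rightMate adj (s.σ g).hom).app ((B.ρ h).obj Y) ≫ H.map ((B.θ g h).hom.app Y) =
          (A.θ g h).hom.app (H.obj Y) ≫ (rightMate adj (s.σ (h * g)).hom).app Y := by
      apply hom_ext_of_map_counit adj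
      have h₁ := map_rightMate_counit adj (s.σ g).hom ((B.ρ h).obj Y)
      have h₂ := map_rightMate_counit adj (s.σ h).hom Y
      have h₃ := map_rightMate_counit adj (s.σ (h * g)).hom Y
      have h₄ := (s.σ g).hom.naturality ((rightMate adj (s.σ h).hom).app Y)
      have h₅ := (B.θ g h).hom.naturality (adj.counit.app Y)
      have h₆ := congrArg (B.ρ g).map h₂
      have h₇ := s.assoc g h (H.obj Y)
      simp only [Functor.comp_obj, Functor.comp_map, Functor.map_comp, Functor.id_obj]
        at h₁ h₂ h₃ h₄ h₅ h₆ h₇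
      simp only [Functor.map_comp, Category.assoc]
      erw [adj.counit_naturality, reassoc_of% h₁, reassoc_of% h₄, reassoc_of% h₆, h₃, h₅,
        reassoc_of% h₇]
    rw [← cancel_epi ((rightMate adj (s.σ g).hom).app ((B.ρ h).obj Y)),
      ← cancel_epi ((A.ρ g).map ((rightMate adj (s.σ h).hom).app Y)), reassoc_of% key]
    have e (k : G) (Z : D) : (rightMate adj (s.σ k).hom).app Z ≫
        (asIso (rightMate adj (s.σ k).hom)).symm.hom.app Z = 𝟙 _ :=
      (asIso (rightMate adj (s.σ k).hom)).hom_inv_id_app Z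
    rw [e, reassoc_of% e, ← Functor.map_comp_assoc, e]
    simp

lemma GFunctor.rightMate_rightAdjoint (s : GFunctor A B F) (adj : F ⊣ H) (g : G) (Y : D) :
    (rightMate adj (s.σ g).hom).app Y ≫ ((s.rightAdjoint adj).σ g).hom.app Y = 𝟙 _ :=
  (asIso (rightMate adj (s.σ g).hom)).hom_inv_id_app Y

lemma GFunctor.isGNatural_unit_rightAdjoint (s : GFunctor A B F) (adj : F ⊣ H) :
    IsGNatural (GFunctor.id A) (s.comp (s.rightAdjoint adj)) adj.unit := by
  intro g X
  have h := unit_map_rightMate adj (s.σ g).hom X =≫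
    ((s.rightAdjoint adj).σ g).hom.app (F.obj X)
  rw [Category.assoc, s.rightMate_rightAdjoint] at h
  simpa using h.symm

lemma GFunctor.isGNatural_counit_rightAdjoint (s : GFunctor A B F) (adj : F ⊣ H) :
    IsGNatural ((s.rightAdjoint adj).comp s) (GFunctor.id B) adj.counit := by
  intro g Y
  have h := F.map (((s.rightAdjoint adj).σ g).hom.app Y) ≫=
    map_rightMate_counit adj (s.σ g).hom Y
  have e : ((s.rightAdjoint adj).σ g).hom.app Y ≫ (rightMate adj (s.σ g).hom).app Y = 𝟙 _ :=
    (asIso (rightMate adj (s.σ g).hom)).inv_hom_id_app Y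
  rw [← Functor.map_comp_assoc, e] at h
  simpa using h

/-- The left adjoint of a `G`-functor is a `G`-functor. -/
def GFunctor.leftAdjoint (t : GFunctor B A H) (adj : F ⊣ H) : GFunctor A B F where
  σ g := asIso (leftMate adj (t.σ g).inv)
  assoc g h X := by
    apply hom_ext_of_unit_map adj
    have h₁ := unit_map_leftMate adj (t.σ g).inv ((A.ρ h).obj X)
    have h₂ := unit_map_leftMate adj (t.σ h).inv X
    have h₃ := unit_map_leftMate adj (t.σ (h * g)).inv X
    have h₄ := (t.σ g).inv.naturality ((leftMate adj (t.σ h).inv).app X)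
    have h₅ := (A.θ g h).hom.naturality (adj.unit.app X)
    have h₆ := congrArg (A.ρ g).map h₂
    have h₇ := t.assoc g h (F.obj X)
    -- This is the coherence of `t` rewritten for the inverses of its structure isomorphisms, whose
    -- mates already point in the direction required for `F`.
    have h₈ : (A.ρ g).map ((t.σ h).inv.app (F.obj X)) ≫ (t.σ g).inv.app ((B.ρ h).obj (F.obj X)) ≫
        H.map ((B.θ g h).hom.app (F.obj X)) =
          (A.θ g h).hom.app (H.obj (F.obj X)) ≫ (t.σ (h * g)).inv.app (F.obj X) := by
      have e (k : G) (Z : D) : (t.σ k).inv.app Z ≫ (t.σ k).hom.app Z = 𝟙 _ :=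
        (t.σ k).inv_hom_id_app Z
      rw [← cancel_mono ((t.σ (h * g)).hom.app (F.obj X))]
      simp only [Category.assoc]
      rw [h₇, reassoc_of% e, ← Functor.map_comp_assoc, e, e]
      simp
    simp only [Functor.comp_obj, Functor.comp_map, Functor.map_comp, Functor.id_obj]
      at h₁ h₂ h₃ h₄ h₅ h₆ h₇
    simp only [Functor.map_comp, asIso_hom]
    erw [reassoc_of% h₁, ← reassoc_of% h₄, reassoc_of% h₆, h₈, reassoc_of% h₅, ← h₃,
      adj.unit_naturality_assoc]

lemma GFunctor.isGNatural_unit_leftAdjoint (t : GFunctor B A H) (adj : F ⊣ H) :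
    IsGNatural (GFunctor.id A) ((t.leftAdjoint adj).comp t) adj.unit := by
  intro g X
  have h := unit_map_leftMate adj (t.σ g).inv X =≫ (t.σ g).hom.app (F.obj X)
  have e : (t.σ g).inv.app (F.obj X) ≫ (t.σ g).hom.app (F.obj X) = 𝟙 _ :=
    (t.σ g).inv_hom_id_app _
  rw [Category.assoc, Category.assoc, e] at h
  simpa [GFunctor.leftAdjoint] using h

lemma GFunctor.isGNatural_counit_leftAdjoint (t : GFunctor B A H) (adj : F ⊣ H) :
    IsGNatural (t.comp (t.leftAdjoint adj)) (GFunctor.id B) adj.counit := by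
  intro g Y
  have h := F.map ((t.σ g).hom.app Y) ≫= leftMate_counit adj (t.σ g).inv Y
  have e : (t.σ g).hom.app Y ≫ (t.σ g).inv.app Y = 𝟙 _ := (t.σ g).hom_inv_id_app _
  rw [← Functor.map_comp_assoc, e] at h
  simpa [GFunctor.leftAdjoint] using h.symm

open EquivariantObject

lemma EquivariantObject.isIso_of_hom {X Y : EquivariantObject A} (f : X ⟶ Y)
    [IsIso (Hom.hom f)] : IsIso f :=
  (isoMk (asIso (Hom.hom f)) f.comm).isIso_hom

instance (X Y : EquivariantObject A) (f : X ⟶ Y) [IsIso f] : IsIso (Hom.hom f) :=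
  inferInstanceAs (IsIso ((forget A).map f))

instance (s : GFunctor A B F) [F.Faithful] : s.equivariant.Faithful where
  map_injective h := hom_ext (F.map_injective (congrArg Hom.hom h))

/-- The preimage of an equivariant morphism commutes with the linearizations because this holds
after applying the faithful functor `F`. -/
instance (s : GFunctor A B F) [F.Full] [F.Faithful] : s.equivariant.Full where
  map_surjective {X Y} f := by
    obtain ⟨f', hf⟩ : ∃ f' : X.obj ⟶ Y.obj, F.map f' = f.hom := F.map_surjective _
    refine ⟨{ hom := f', comm := fun g => F.map_injective ?_ }, hom_ext hf⟩
    have h₁ : (F.map (X.χ g).hom ≫ (s.σ g).hom.app X.obj) ≫ (B.ρ g).map (F.map f') =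
        F.map f' ≫ F.map (Y.χ g).hom ≫ (s.σ g).hom.app Y.obj := by
      rw [hf]
      exact f.comm g
    have h₂ : F.map ((A.ρ g).map f') ≫ (s.σ g).hom.app Y.obj =
        (s.σ g).hom.app X.obj ≫ (B.ρ g).map (F.map f') := (s.σ g).hom.naturality f'
    rw [← cancel_mono ((s.σ g).hom.app Y.obj), Functor.map_comp, Functor.map_comp,
      Category.assoc, Category.assoc]
    erw [h₂]
    rw [← h₁, Category.assoc]

end Adjoints

/-! ### Shift compatibility of adjoint structures and equivariant adjunctions -/

section Triangulated

variable {G : Type w} [Group G]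
  {C : Type u₁} [Category.{v₁} C] [HasZeroObject C] [HasShift C ℤ] [Preadditive C]
  [∀ n : ℤ, (shiftFunctor C n).Additive] [Pretriangulated C]
  {D : Type u₂} [Category.{v₂} D] [HasZeroObject D] [HasShift D ℤ] [Preadditive D]
  [∀ n : ℤ, (shiftFunctor D n).Additive] [Pretriangulated D]
  {A : RightAction G C} {B : RightAction G D} [Admissible A] [Admissible B]
  {F : C ⥤ D} {H : D ⥤ C} [F.CommShift ℤ] [H.CommShift ℤ] (adj : F ⊣ H) [adj.CommShift ℤ]

instance (s : GFunctor A B F) [IsTriangulatedGFunctor s] :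
    IsTriangulatedGFunctor (s.rightAdjoint adj) where
  commShift_σ g := by
    have : NatTrans.CommShift (asIso (rightMate adj (s.σ g).hom)).hom ℤ :=
      inferInstanceAs (NatTrans.CommShift (rightMate adj (s.σ g).hom) ℤ)
    exact NatTrans.CommShift.of_iso_symm _ ℤ

instance (t : GFunctor B A H) [IsTriangulatedGFunctor t] :
    IsTriangulatedGFunctor (t.leftAdjoint adj) where
  commShift_σ g := inferInstanceAs (NatTrans.CommShift (leftMate adj (t.σ g).inv) ℤ)

section Equivariant

open EquivariantObject

lemma commShift_equivariantAdjunction (s : GFunctor A B F) (t : GFunctor B A H)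
    [IsTriangulatedGFunctor s] [IsTriangulatedGFunctor t]
    (hunit : IsGNatural (GFunctor.id A) (s.comp t) adj.unit)
    (hcounit : IsGNatural (t.comp s) (GFunctor.id B) adj.counit) :
    (equivariantAdjunction s t adj hunit hcounit).CommShift ℤ := by
  -- Compatibility of the unit with the shifts suffices, and the unit has the same underlying
  -- morphisms as `adj.unit`.
  refine .mk' _ _ ⟨fun n => ?_⟩
  ext X
  have := NatTrans.shift_app_comm adj.unit n X.obj
  rw [Functor.commShiftIso_comp_hom_app] at this
  simp only [NatTrans.comp_app, Functor.commShiftIso_comp_hom_app]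
  exact this

lemma EquivariantObject.isZero_iff (X : EquivariantObject A) : IsZero X ↔ IsZero X.obj := by
  rw [IsZero.iff_id_eq_zero, IsZero.iff_id_eq_zero, EquivariantObject.hom_ext_iff]
  rfl

end Equivariant

end Triangulated

/-! ### Canonical triangulated structures by localization -/

section Canonical

open EquivariantObject Pretriangulated MorphismProperty

variable {G : Type w} [Group G]
  {C : Type u₁} [Category.{v₁} C] [HasZeroObject C] [HasShift C ℤ] [Preadditive C]
  [∀ n : ℤ, (shiftFunctor C n).Additive] [Pretriangulated C]
  {D : Type u₂} [Category.{v₂} D] [HasZeroObject D] [HasShift D ℤ] [Preadditive D]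
  [∀ n : ℤ, (shiftFunctor D n).Additive] [Pretriangulated D]
  {A : RightAction G C} {B : RightAction G D} [Admissible A] [Admissible B]
  {F : C ⥤ D} {H : D ⥤ C} [F.CommShift ℤ] [F.IsTriangulated]

/-- The class of morphisms of `C^G` inverted by `F^G` is compatible with a canonical triangulated
structure on `C^G`. -/
lemma isCompatibleWithTriangulation (PC : CanonicalTriangulation A) (s : GFunctor A B F)
    [IsTriangulatedGFunctor s] :
    letI := PC.pretriangulated
    ((isomorphisms (EquivariantObject B)).inverseImage
      s.equivariant).IsCompatibleWithTriangulation := by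
  let := PC.pretriangulated
  have := PC.forget_isTriangulated
  have hW : ((isomorphisms (EquivariantObject B)).inverseImage
      s.equivariant).IsCompatibleWithShift ℤ := ⟨fun n => by
    ext X Y f
    change IsIso (s.equivariant.map (f⟦n⟧')) ↔ IsIso (s.equivariant.map f)
    rw [← isIso_iff_of_reflects_iso (s.equivariant.map f)
      (shiftFunctor (EquivariantObject B) n)]
    exact NatIso.isIso_map_iff (s.equivariant.commShiftIso n) f⟩
  refine { hW with compatible_with_triangulation := ?_ }
  intro T₁ T₂ hT₁ hT₂ a b ha hb fac
  obtain ⟨c, hc₁, hc₂⟩ := complete_distinguished_triangle_morphism T₁ T₂ hT₁ hT₂ a b fac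
  refine ⟨c, ?_, hc₁, hc₂⟩
  let φ : T₁ ⟶ T₂ := { hom₁ := a, hom₂ := b, hom₃ := c, comm₁ := fac, comm₂ := hc₁, comm₃ := hc₂ }
  -- At this point `D^G` carries no triangulated structure, so the five lemma is applied in `D`, to
  -- the image under `forget A ⋙ F`. Invertibility of the underlying morphism then lifts to `D^G`.
  have h (T : Triangle (EquivariantObject A)) (hT : T ∈ distTriang _) :
      (forget A ⋙ F).mapTriangle.obj T ∈ distTriang _ := (forget A ⋙ F).map_distinguished T hT
  have ha' : IsIso (s.equivariant.map a) := ha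
  have hb' : IsIso (s.equivariant.map b) := hb
  have : IsIso (Hom.hom (s.equivariant.map c)) :=
    isIso₃_of_isIso₁₂ ((forget A ⋙ F).mapTriangle.map φ) (h _ hT₁) (h _ hT₂)
      (inferInstanceAs (IsIso (Hom.hom (s.equivariant.map a))))
      (inferInstanceAs (IsIso (Hom.hom (s.equivariant.map b))))
  exact isIso_of_hom (s.equivariant.map c)

/-- The identity `F^G ⋙ For = For ⋙ F`. -/
def equivariantForgetIso (s : GFunctor A B F) : s.equivariant ⋙ forget B ≅ forget A ⋙ F :=
  NatIso.ofComponents (fun X => Iso.refl (F.obj X.obj)) (fun _ =>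
    (Category.comp_id _).trans (Category.id_comp _).symm)

instance (s : GFunctor A B F) [IsTriangulatedGFunctor s] :
    NatTrans.CommShift (equivariantForgetIso s).hom ℤ := ⟨fun n => by
  ext X
  simp only [NatTrans.comp_app, Functor.commShiftIso_comp_hom_app, Functor.whiskerRight_app,
    Functor.whiskerLeft_app]
  change ((F.commShiftIso n).hom.app X.obj ≫ 𝟙 _) ≫ (𝟙 (F.obj X.obj))⟦n⟧' =
    𝟙 _ ≫ F.map (𝟙 _) ≫ (F.commShiftIso n).hom.app X.obj
  simp⟩

/-- If a triangulated `G`-functor `F : C ⥤ D` has a fully faithful right adjoint `G`-functor, a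
canonical triangulated structure on `C^G` induces one on `D^G` such that `F^G` is triangulated. -/
lemma exists_canonicalTriangulation (PC : CanonicalTriangulation A) (s : GFunctor A B F)
    [IsTriangulatedGFunctor s] (t : GFunctor B A H) [H.Full] [H.Faithful]
    (adj : s.equivariant ⊣ t.equivariant) :
    letI := PC.pretriangulated
    ∃ PD : CanonicalTriangulation B,
      letI := PD.pretriangulated
      s.equivariant.IsTriangulated := by
  let := PC.pretriangulated
  have := PC.isTriangulated
  have := PC.forget_isTriangulated
  let W := (isomorphisms (EquivariantObject B)).inverseImage s.equivariant
  have : W.IsCompatibleWithTriangulation := isCompatibleWithTriangulation PC s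
  have : W.HasLeftCalculusOfFractions := adj.hasLeftCalculusOfFractions'
  have : s.equivariant.IsLocalization W := adj.isLocalization_leftAdjoint'
  have : s.equivariant.Additive := ⟨fun {_ _ f g} => hom_ext (F.map_add (f := f.hom) (g := g.hom))⟩
  let : Pretriangulated (EquivariantObject B) :=
    Triangulated.Localization.pretriangulated s.equivariant W
  have hs : s.equivariant.IsTriangulated :=
    Triangulated.Localization.isTriangulated_functor s.equivariant W
  -- Every morphism of `D^G` is, up to isomorphism, the image of one in `C^G`. So exactness of the
  -- forgetful functor can be tested after precomposition with `F^G`, where it becomes `forget A ⋙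
  -- F`.
  have := Localization.essSurj_mapArrow s.equivariant W
  exact ⟨⟨inferInstance, Triangulated.Localization.isTriangulated s.equivariant W,
    Functor.isTriangulated_of_precomp_iso (equivariantForgetIso s)⟩, hs⟩

end Canonical

/-! ### Transfer of actions along localizations and fully faithful functors -/

section Transfer

variable {G : Type w} [Group G]
  {C : Type u₁} [Category.{v₁} C] {D : Type u₂} [Category.{v₂} D]

/-- The isomorphism `ρ_1 ≅ 𝟭`. -/
def RightAction.oneIso (A : RightAction G C) : A.ρ 1 ≅ 𝟭 C :=
  -- No unit isomorphism belongs to the data of an action. It is recovered by cancelling the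
  -- equivalence `ρ_1` from `θ_{1,1} : ρ_1 ρ_1 ≅ ρ_1`.
  ((Functor.FullyFaithful.ofFullyFaithful (A.ρ 1)).whiskeringRight C).preimageIso
    (A.θ 1 1 ≪≫ eqToIso (by rw [mul_one]) ≪≫ (Functor.leftUnitor _).symm)

/-- The functor `ρ_{g⁻¹}` is a quasi-inverse of `ρ_g`. The cocycle identity plays no role here. -/
lemma isEquivalence_of_multiplicative {ρ : G → C ⥤ C} (θ : ∀ g h, ρ h ⋙ ρ g ≅ ρ (h * g))
    (one : ρ 1 ≅ 𝟭 C) (g : G) : (ρ g).IsEquivalence :=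
  (CategoryTheory.Equivalence.mk (ρ g) (ρ g⁻¹)
    (θ g⁻¹ g ≪≫ eqToIso (by rw [mul_inv_cancel]) ≪≫ one).symm
    (θ g g⁻¹ ≪≫ eqToIso (by rw [inv_mul_cancel]) ≪≫ one)).isEquivalence_functor

section Descend

variable (A : RightAction G C) {L : C ⥤ D} {ρ : G → D ⥤ D} (σ : ∀ g, A.ρ g ⋙ L ≅ L ⋙ ρ g)

/-- The composition isomorphisms of a descended action, restricted along `L`. -/
def descendCompIso (g h : G) : L ⋙ ρ h ⋙ ρ g ≅ L ⋙ ρ (h * g) :=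
  (Functor.associator _ _ _).symm ≪≫ Functor.isoWhiskerRight (σ h).symm (ρ g) ≪≫
    Functor.associator _ _ _ ≪≫ Functor.isoWhiskerLeft (A.ρ h) (σ g).symm ≪≫
    (Functor.associator _ _ _).symm ≪≫ Functor.isoWhiskerRight (A.θ g h) L ≪≫ σ (h * g)

variable (hL : ((Functor.whiskeringLeft C D D).obj L).FullyFaithful)

/-- The composition isomorphisms of a descended action. -/
def descendTheta (g h : G) : ρ h ⋙ ρ g ≅ ρ (h * g) :=
  hL.preimageIso (descendCompIso A σ g h)

lemma whiskerLeft_descendTheta (g h : G) :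
    Functor.whiskerLeft L (descendTheta A σ hL g h).hom = (descendCompIso A σ g h).hom :=
  hL.map_preimage _

/-- This is the coherence that makes `L` a `G`-functor; it determines the descended isomorphisms on
the image of `L`. -/
lemma descendTheta_app (g h : G) (X : C) :
    (σ g).hom.app ((A.ρ h).obj X) ≫ (ρ g).map ((σ h).hom.app X) ≫
      (descendTheta A σ hL g h).hom.app (L.obj X) =
    L.map ((A.θ g h).hom.app X) ≫ (σ (h * g)).hom.app X := by
  have := congr_app (whiskerLeft_descendTheta A σ hL g h) X
  simp only [Functor.whiskerLeft_app] at this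
  rw [this]
  simp [descendCompIso, ← Functor.map_comp_assoc]

lemma map_eqToHom_sigma {a b : G} (h : a = b) (X : C) :
    L.map (eqToHom (by rw [h] : (A.ρ a).obj X = (A.ρ b).obj X)) ≫ (σ b).hom.app X =
      (σ a).hom.app X ≫ eqToHom (by rw [h]) := by
  subst h
  simp

lemma descendTheta_cocycle_app (g h k : G) (X : C) :
    (ρ g).map ((descendTheta A σ hL h k).hom.app (L.obj X)) ≫
        (descendTheta A σ hL g (k * h)).hom.app (L.obj X) =
      (descendTheta A σ hL g h).hom.app ((ρ k).obj (L.obj X)) ≫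
        (descendTheta A σ hL (h * g) k).hom.app (L.obj X) ≫ eqToHom (by rw [mul_assoc]) := by
  have h₁ := descendTheta_app A σ hL h k X
  have h₂ := descendTheta_app A σ hL g (k * h) X
  have h₃ := descendTheta_app A σ hL g h ((A.ρ k).obj X)
  have h₄ := descendTheta_app A σ hL (h * g) k X
  have h₅ := (descendTheta A σ hL g h).hom.naturality ((σ k).hom.app X)
  have h₆ := (σ g).hom.naturality ((A.θ h k).hom.app X)
  have h₇ := congrArg L.map (A.cocycle g h k X)
  have h₈ := map_eqToHom_sigma A σ (mul_assoc k h g).symm X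
  have h₉ := congrArg (ρ g).map h₁
  simp only [Functor.comp_obj, Functor.comp_map, Functor.map_comp] at h₁ h₂ h₃ h₄ h₅ h₆ h₇ h₈ h₉
  -- After precomposition with three instances of `σ`, both sides become the images under `L` of the
  -- two sides of the cocycle identity of `A`, followed by `σ`.
  rw [← cancel_epi ((ρ g).map ((ρ h).map ((σ k).hom.app X))),
    ← cancel_epi ((ρ g).map ((σ h).hom.app ((A.ρ k).obj X))),
    ← cancel_epi ((σ g).hom.app ((A.ρ h).obj ((A.ρ k).obj X)))]
  rw [reassoc_of% h₉, ← reassoc_of% h₆, h₂, reassoc_of% h₇, reassoc_of% h₅, reassoc_of% h₃,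
    reassoc_of% h₄, h₈]

/-- An action on `C` descends along `L : C ⥤ D` if precomposition with `L` is fully faithful. -/
def RightAction.descend : RightAction G D where
  ρ := ρ
  isEquivalence := isEquivalence_of_multiplicative (descendTheta A σ hL)
    (hL.preimageIso ((σ 1).symm ≪≫ Functor.isoWhiskerRight A.oneIso L ≪≫
      Functor.leftUnitor _ ≪≫ (Functor.rightUnitor _).symm))
  θ := descendTheta A σ hL
  cocycle g h k Y := by
    let α : ρ k ⋙ ρ h ⋙ ρ g ⟶ ρ (k * h * g) :=
      Functor.whiskerRight (descendTheta A σ hL h k).hom (ρ g) ≫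
        (descendTheta A σ hL g (k * h)).hom
    let β : ρ k ⋙ ρ h ⋙ ρ g ⟶ ρ (k * h * g) :=
      Functor.whiskerLeft (ρ k) (descendTheta A σ hL g h).hom ≫
        (descendTheta A σ hL (h * g) k).hom ≫ eqToHom (by rw [mul_assoc])
    -- Two transformations that agree after precomposition with `L` are equal, so the cocycle
    -- identity is needed only on objects `L X`.
    have : α = β := hL.map_injective (by
      ext X
      have := descendTheta_cocycle_app A σ hL g h k X
      simpa [α, β, eqToHom_app] using this)
    simpa [α, β, eqToHom_app] using congr_app this Y

/-- The functor along which an action descends is a `G`-functor. -/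
def GFunctor.descend : GFunctor A (A.descend σ hL) L where
  σ := σ
  assoc g h X := (descendTheta_app A σ hL g h X).symm

end Descend

section Restrict

variable (A : RightAction G C) {L : D ⥤ C} {ρ : G → D ⥤ D} (σ : ∀ g, ρ g ⋙ L ≅ L ⋙ A.ρ g)

/-- The composition isomorphisms of a restricted action, composed with `L`. -/
def restrictCompIso (g h : G) : (ρ h ⋙ ρ g) ⋙ L ≅ ρ (h * g) ⋙ L :=
  Functor.associator _ _ _ ≪≫ Functor.isoWhiskerLeft (ρ h) (σ g) ≪≫
    (Functor.associator _ _ _).symm ≪≫ Functor.isoWhiskerRight (σ h) (A.ρ g) ≪≫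
    Functor.associator _ _ _ ≪≫ Functor.isoWhiskerLeft L (A.θ g h) ≪≫ (σ (h * g)).symm

variable (hL : L.FullyFaithful)

/-- The composition isomorphisms of a restricted action. -/
def restrictTheta (g h : G) : ρ h ⋙ ρ g ≅ ρ (h * g) :=
  (hL.whiskeringRight D).preimageIso (restrictCompIso A σ g h)

lemma whiskerRight_restrictTheta (g h : G) :
    Functor.whiskerRight (restrictTheta A σ hL g h).hom L = (restrictCompIso A σ g h).hom :=
  (hL.whiskeringRight D).map_preimage _

lemma restrictTheta_app (g h : G) (X : D) :
    L.map ((restrictTheta A σ hL g h).hom.app X) ≫ (σ (h * g)).hom.app X =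
      (σ g).hom.app ((ρ h).obj X) ≫ (A.ρ g).map ((σ h).hom.app X) ≫
        (A.θ g h).hom.app (L.obj X) := by
  have := congr_app (whiskerRight_restrictTheta A σ hL g h) X
  simp only [Functor.whiskerRight_app] at this
  rw [this]
  simp [restrictCompIso]

lemma map_eqToHom_sigma' {a b : G} (h : a = b) (X : D) :
    L.map (eqToHom (by rw [h] : (ρ a).obj X = (ρ b).obj X)) ≫ (σ b).hom.app X =
      (σ a).hom.app X ≫ eqToHom (by rw [h]) := by
  subst h
  simp

/-- The restriction of an action on `C` to an invariant full subcategory `L : D ⥤ C`. -/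
def RightAction.restrict : RightAction G D where
  ρ := ρ
  isEquivalence := isEquivalence_of_multiplicative (restrictTheta A σ hL)
    ((hL.whiskeringRight D).preimageIso (σ 1 ≪≫ Functor.isoWhiskerLeft L A.oneIso ≪≫
      Functor.rightUnitor _ ≪≫ (Functor.leftUnitor _).symm))
  θ := restrictTheta A σ hL
  cocycle g h k X := by
    apply hL.map_injective
    have h₁ := restrictTheta_app A σ hL h k X
    have h₂ := restrictTheta_app A σ hL g (k * h) X
    have h₃ := restrictTheta_app A σ hL g h ((ρ k).obj X)
    have h₄ := restrictTheta_app A σ hL (h * g) k X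
    have h₅ := (A.θ g h).hom.naturality ((σ k).hom.app X)
    have h₆ := (σ g).hom.naturality ((restrictTheta A σ hL h k).hom.app X)
    have h₇ := A.cocycle g h k (L.obj X)
    have h₈ := map_eqToHom_sigma' A σ (mul_assoc k h g).symm X
    have h₉ := congrArg (A.ρ g).map h₁
    simp only [Functor.comp_obj, Functor.comp_map, Functor.map_comp] at h₁ h₂ h₃ h₄ h₅ h₆ h₇ h₈ h₉
    -- After applying the faithful functor `L`, postcomposition with `σ` reduces the identity to the
    -- cocycle identity of `A` at `L X`.
    rw [← cancel_mono ((σ (k * h * g)).hom.app X)]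
    simp only [Functor.map_comp, Category.assoc]
    rw [h₂, reassoc_of% h₆, reassoc_of% h₉, h₇]
    erw [h₈]
    rw [reassoc_of% h₄, reassoc_of% h₃, reassoc_of% h₅]

/-- The functor along which an action is restricted is a `G`-functor. -/
def GFunctor.restrict : GFunctor (A.restrict σ hL) A L where
  σ := σ
  assoc g h X := restrictTheta_app A σ hL g h X

end Restrict

end Transfer

/-! ### Shift compatibility of the transferred actions -/

section Shift

variable {C : Type u₁} [Category.{v₁} C] [HasShift C ℤ]
  {D : Type u₂} [Category.{v₂} D] [HasShift D ℤ]
  {E : Type u₃} [Category.{v₃} E] [HasShift E ℤ]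

/-- Compatibility at an object is invariant under isomorphism, and every object is isomorphic to
some `L X`. -/
lemma commShift_of_whiskerLeft (L : C ⥤ D) [L.CommShift ℤ] [L.EssSurj] {F H : D ⥤ E}
    [F.CommShift ℤ] [H.CommShift ℤ] (τ : F ⟶ H)
    [NatTrans.CommShift (Functor.whiskerLeft L τ) ℤ] : NatTrans.CommShift τ ℤ := ⟨fun n => by
  ext Y
  have e := L.objObjPreimageIso Y
  rw [← cancel_epi (F.map (e.hom⟦n⟧'))]
  have h := NatTrans.shift_app_comm (Functor.whiskerLeft L τ) n (L.objPreimage Y)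
  have h' := τ.naturality ((L.commShiftIso n).hom.app (L.objPreimage Y))
  simp only [Functor.commShiftIso_comp_hom_app, Functor.whiskerLeft_app, Category.assoc,
    Functor.comp_obj] at h h'
  rw [← reassoc_of% h', cancel_epi] at h
  have h₁ := (F.commShiftIso n).hom.naturality e.hom
  have h₂ := (H.commShiftIso n).hom.naturality e.hom
  have h₃ := τ.naturality e.hom
  have h₄ := τ.naturality (e.hom⟦n⟧')
  simp only [Functor.comp_map, Functor.comp_obj] at h₁ h₂ h₃ h₄
  simp only [NatTrans.comp_app, Functor.whiskerLeft_app, Functor.whiskerRight_app]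
  rw [reassoc_of% h₁, ← Functor.map_comp, h₃, Functor.map_comp, reassoc_of% h,
    reassoc_of% h₄, h₂]⟩

lemma commShift_of_whiskerRight (L : D ⥤ E) [L.CommShift ℤ] [L.Faithful] {F H : C ⥤ D}
    [F.CommShift ℤ] [H.CommShift ℤ] (τ : F ⟶ H)
    [NatTrans.CommShift (Functor.whiskerRight τ L) ℤ] : NatTrans.CommShift τ ℤ := ⟨fun n => by
  ext X
  apply L.map_injective
  have h := NatTrans.shift_app_comm (Functor.whiskerRight τ L) n X
  have h' := (L.commShiftIso n).hom.naturality (τ.app X)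
  simp only [Functor.commShiftIso_comp_hom_app, Functor.whiskerRight_app, Category.assoc,
    Functor.comp_obj, Functor.comp_map] at h h'
  rw [← h', ← Functor.map_comp_assoc, ← Functor.map_comp_assoc, cancel_mono] at h
  exact h⟩

end Shift

section Transfer

variable {G : Type w} [Group G]
  {C : Type u₁} [Category.{v₁} C] [HasZeroObject C] [HasShift C ℤ] [Preadditive C]
  [∀ n : ℤ, (shiftFunctor C n).Additive] [Pretriangulated C]
  {D : Type u₂} [Category.{v₂} D] [HasZeroObject D] [HasShift D ℤ] [Preadditive D]
  [∀ n : ℤ, (shiftFunctor D n).Additive] [Pretriangulated D]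
  (A : RightAction G C) [Admissible A] {ρ : G → D ⥤ D} [∀ g, (ρ g).CommShift ℤ]
  [∀ g, (ρ g).IsTriangulated]

section

variable {L : C ⥤ D} [L.CommShift ℤ] [L.EssSurj] (σ : ∀ g, A.ρ g ⋙ L ≅ L ⋙ ρ g)
  [∀ g, NatTrans.CommShift (σ g).hom ℤ]
  (hL : ((Functor.whiskeringLeft C D D).obj L).FullyFaithful)

instance admissibleDescend : Admissible (A.descend σ hL) where
  commShift g := inferInstanceAs ((ρ g).CommShift ℤ)
  isTriangulated g := inferInstanceAs ((ρ g).IsTriangulated)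
  commShift_θ g h := by
    have : NatTrans.CommShift (Functor.whiskerLeft L (descendTheta A σ hL g h).hom) ℤ := by
      rw [whiskerLeft_descendTheta]
      dsimp only [descendCompIso, Iso.trans_hom, Iso.symm_hom, Functor.isoWhiskerRight_hom,
        Functor.isoWhiskerLeft_hom]
      infer_instance
    exact commShift_of_whiskerLeft L (descendTheta A σ hL g h).hom

instance : IsTriangulatedGFunctor (GFunctor.descend A σ hL) where
  commShift_σ g := inferInstanceAs (NatTrans.CommShift (σ g).hom ℤ)

end

section

variable {L : D ⥤ C} [L.CommShift ℤ] [L.Faithful] (σ : ∀ g, ρ g ⋙ L ≅ L ⋙ A.ρ g)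
  [∀ g, NatTrans.CommShift (σ g).hom ℤ] (hL : L.FullyFaithful)

instance admissibleRestrict : Admissible (A.restrict σ hL) where
  commShift g := inferInstanceAs ((ρ g).CommShift ℤ)
  isTriangulated g := inferInstanceAs ((ρ g).IsTriangulated)
  commShift_θ g h := by
    have : NatTrans.CommShift (Functor.whiskerRight (restrictTheta A σ hL g h).hom L) ℤ := by
      rw [whiskerRight_restrictTheta]
      dsimp only [restrictCompIso, Iso.trans_hom, Iso.symm_hom, Functor.isoWhiskerRight_hom,
        Functor.isoWhiskerLeft_hom]
      infer_instance
    exact commShift_of_whiskerRight L (restrictTheta A σ hL g h).hom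

instance : IsTriangulatedGFunctor (GFunctor.restrict A σ hL) where
  commShift_σ g := inferInstanceAs (NatTrans.CommShift (σ g).hom ℤ)

end

end Transfer

/-! ### Actions on the outer terms and the equivariant recollement -/

section Recollement

variable {U : Type u₁} [Category.{v₁} U] [HasZeroObject U] [HasShift U ℤ] [Preadditive U]
  [∀ n : ℤ, (shiftFunctor U n).Additive] [Pretriangulated U]
  {T : Type u₂} [Category.{v₂} T] [HasZeroObject T] [HasShift T ℤ] [Preadditive T]
  [∀ n : ℤ, (shiftFunctor T n).Additive] [Pretriangulated T]
  {V : Type u₃} [Category.{v₃} V] [HasZeroObject V] [HasShift V ℤ] [Preadditive V]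
  [∀ n : ℤ, (shiftFunctor V n).Additive] [Pretriangulated V]
  {R : RecollementDiagram U T V} (hR : R.IsRecollement) {G : Type w} [Group G]
  (AT : RightAction G T)

include hR

open Pretriangulated

namespace RecollementDiagram.IsRecollement

/-- If `e X = 0` then `e (X^g) ≅ (e X)^g = 0`, and `Ker e` is the image of `i`. Shifts do not enter.
-/
lemma isGInvariant_of_gFunctor {AV : RightAction G V} (s : GFunctor AT AV R.e) :
    IsGInvariant AT R.i.essImage := by
  intro g X hX
  rw [hR.essImage_i_iff] at hX ⊢
  exact ((AV.ρ g).map_isZero hX).of_iso ((s.σ g).app X)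

/-- This makes `e ρ_g` factor through `e`: it inverts the units `X ⟶ r e X`, because their cones lie
in the invariant subcategory `U`. -/
lemma isIso_map_unit [Admissible AT] (h : IsGInvariant AT R.i.essImage) (g : G) (X : T) :
    IsIso (R.e.map ((AT.ρ g).map (R.adj_er.unit.app X))) := by
  have := hR.isTriangulated_e
  obtain ⟨Z, a, b, hZ⟩ := distinguished_cocone_triangle (R.adj_er.unit.app X)
  have := hR.full_r
  have := hR.faithful_r
  -- As `r` is fully faithful, `e` inverts the unit and therefore kills its cone.
  have h₁ : IsZero (R.e.obj Z) := Triangle.isZero₃_of_isIso₁ _ (R.e.map_distinguished _ hZ)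
    (inferInstanceAs (IsIso (R.e.map (R.adj_er.unit.app X))))
  have h₂ := (hR.essImage_i_iff _).1 (h g Z ((hR.essImage_i_iff Z).2 h₁))
  exact (Triangle.isZero₃_iff_isIso₁ _ ((AT.ρ g ⋙ R.e).map_distinguished _ hZ)).1 h₂

/-- On the invariant subcategory `U` the unit of `q ⊣ i` is invertible, so `i q ρ_g i ≅ ρ_g i`,
compatibly with shifts. The action then restricts along `i`. -/
theorem exists_action_left [Admissible AT] (h : IsGInvariant AT R.i.essImage) :
    ∃ (AU : RightAction G U) (_ : Admissible AU) (s : GFunctor AU AT R.i),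
      IsTriangulatedGFunctor s := by
  have := hR.full_i
  have := hR.faithful_i
  have := hR.isTriangulated_i
  have := hR.isTriangulated_q
  have := hR.commShift_qi
  let ρ (g : G) : U ⥤ U := R.i ⋙ AT.ρ g ⋙ R.q
  let τ (g : G) : R.i ⋙ AT.ρ g ⟶ ρ g ⋙ R.i :=
    (Functor.rightUnitor _).inv ≫ Functor.whiskerLeft (R.i ⋙ AT.ρ g) R.adj_qi.unit ≫
      (Functor.associator _ _ _).inv ≫
      Functor.whiskerRight (Functor.associator R.i (AT.ρ g) R.q).hom R.i
  have hτ (g : G) : IsIso (τ g) := by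
    have (X : U) : IsIso ((τ g).app X) := by
      have := R.adj_qi.isIso_unit_app_iff_mem_essImage.2 (h g _ (R.i.obj_mem_essImage X))
      simpa [τ] using this
    exact NatIso.isIso_of_isIso_app _
  let σ (g : G) : ρ g ⋙ R.i ≅ R.i ⋙ AT.ρ g := (asIso (τ g)).symm
  have hσ (g : G) : NatTrans.CommShift (σ g).hom ℤ := by
    have : NatTrans.CommShift (asIso (τ g)).hom ℤ :=
      inferInstanceAs (NatTrans.CommShift (τ g) ℤ)
    exact NatTrans.CommShift.of_iso_symm _ ℤ
  have (g : G) : (ρ g).IsTriangulated :=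
    inferInstanceAs ((R.i ⋙ AT.ρ g ⋙ R.q).IsTriangulated)
  exact ⟨AT.restrict σ (Functor.FullyFaithful.ofFullyFaithful R.i), inferInstance,
    GFunctor.restrict AT σ _, inferInstance⟩

theorem exists_action_right [Admissible AT] (h : IsGInvariant AT R.i.essImage) :
    ∃ (AV : RightAction G V) (_ : Admissible AV) (s : GFunctor AT AV R.e),
      IsTriangulatedGFunctor s := by
  have := hR.full_r
  have := hR.faithful_r
  have := hR.isTriangulated_e
  have := hR.isTriangulated_r
  have := hR.commShift_er
  -- Being a localization makes precomposition with `e` fully faithful, which gives descent of `θ`.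
  -- Essential surjectivity gives its shift compatibility.
  have hL := R.adj_er.isLocalization_leftAdjoint'
  have := Localization.essSurj R.e ((MorphismProperty.isomorphisms V).inverseImage R.e)
  let ρ (g : G) : V ⥤ V := R.r ⋙ AT.ρ g ⋙ R.e
  let τ (g : G) : AT.ρ g ⋙ R.e ⟶ R.e ⋙ ρ g :=
    (Functor.leftUnitor _).inv ≫ Functor.whiskerRight R.adj_er.unit (AT.ρ g ⋙ R.e) ≫
      (Functor.associator _ _ _).hom
  have hτ (g : G) : IsIso (τ g) := by
    have (X : T) : IsIso ((τ g).app X) := by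
      simpa [τ] using hR.isIso_map_unit AT h g X
    exact NatIso.isIso_of_isIso_app _
  let σ (g : G) : AT.ρ g ⋙ R.e ≅ R.e ⋙ ρ g := asIso (τ g)
  have hσ (g : G) : NatTrans.CommShift (σ g).hom ℤ :=
    inferInstanceAs (NatTrans.CommShift (τ g) ℤ)
  have (g : G) : (ρ g).IsTriangulated :=
    inferInstanceAs ((R.r ⋙ AT.ρ g ⋙ R.e).IsTriangulated)
  exact ⟨AT.descend σ (Localization.fullyFaithfulWhiskeringLeft R.e
    ((MorphismProperty.isomorphisms V).inverseImage R.e) V), inferInstance,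
    GFunctor.descend AT σ _, inferInstance⟩

variable {AT}

/-- The triangulated `G`-functor structures on the adjoints of `i` and `e`. -/
def gStructure {AU : RightAction G U} {AV : RightAction G V} [Admissible AU] [Admissible AT]
    [Admissible AV] (si : GFunctor AU AT R.i) (se : GFunctor AT AV R.e)
    [IsTriangulatedGFunctor si] [IsTriangulatedGFunctor se] : R.GStructure AU AT AV where
  i := si
  q := si.leftAdjoint R.adj_qi
  p := si.rightAdjoint R.adj_ip
  e := se
  l := se.leftAdjoint R.adj_le
  r := se.rightAdjoint R.adj_er
  isTriangulated_i := inferInstance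
  isTriangulated_q := have := hR.commShift_qi; inferInstance
  isTriangulated_p := have := hR.commShift_ip; inferInstance
  isTriangulated_e := inferInstance
  isTriangulated_l := have := hR.commShift_le; inferInstance
  isTriangulated_r := have := hR.commShift_er; inferInstance
  unit_qi := si.isGNatural_unit_leftAdjoint _
  counit_qi := si.isGNatural_counit_leftAdjoint _
  unit_ip := si.isGNatural_unit_rightAdjoint _
  counit_ip := si.isGNatural_counit_rightAdjoint _
  unit_le := se.isGNatural_unit_leftAdjoint _
  counit_le := se.isGNatural_counit_leftAdjoint _
  unit_er := se.isGNatural_unit_rightAdjoint _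
  counit_er := se.isGNatural_counit_rightAdjoint _

open EquivariantObject in
lemma essImage_equivariant_iff {AU : RightAction G U} {AV : RightAction G V} [Admissible AU]
    [Admissible AT] [Admissible AV] (S : R.GStructure AU AT AV) (X : EquivariantObject AT) :
    S.i.equivariant.essImage X ↔ IsZero (S.e.equivariant.obj X) := by
  rw [EquivariantObject.isZero_iff]
  have := hR.full_i
  have := hR.faithful_i
  constructor
  · rintro ⟨Y, ⟨f⟩⟩
    exact (hR.essImage_i_iff X.obj).1 ⟨Y.obj, ⟨(forget AT).mapIso f⟩⟩
  · intro hX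
    let adj := equivariantAdjunction S.q S.i R.adj_qi S.unit_qi S.counit_qi
    -- The equivariant unit has this underlying morphism, so `X` is isomorphic in `T^G`, with its
    -- linearization, to `i^G q^G X`.
    have h : IsIso (R.adj_qi.unit.app X.obj) :=
      R.adj_qi.isIso_unit_app_iff_mem_essImage.2 ((hR.essImage_i_iff _).2 hX)
    have h' : IsIso (Hom.hom (adj.unit.app X)) := h
    have := isIso_of_hom (adj.unit.app X)
    exact adj.mem_essImage_of_unit_isIso X

theorem exists_equivariant {AU : RightAction G U} {AV : RightAction G V} [Admissible AU]
    [Admissible AT] [Admissible AV] (S : R.GStructure AU AT AV) (PT : CanonicalTriangulation AT) :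
    ∃ (PU : CanonicalTriangulation AU) (PV : CanonicalTriangulation AV),
      R.IsEquivariantRecollement S PU PT PV := by
  have := hR.full_i
  have := hR.faithful_i
  have := hR.full_l
  have := hR.faithful_l
  have := hR.full_r
  have := hR.faithful_r
  have := hR.isTriangulated_q
  have := hR.isTriangulated_e
  have := hR.commShift_qi
  have := hR.commShift_ip
  have := hR.commShift_le
  have := hR.commShift_er
  obtain ⟨PU, hq⟩ := exists_canonicalTriangulation PT S.q S.i
    (equivariantAdjunction S.q S.i R.adj_qi S.unit_qi S.counit_qi)
  obtain ⟨PV, he⟩ := exists_canonicalTriangulation PT S.e S.r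
    (equivariantAdjunction S.e S.r R.adj_er S.unit_er S.counit_er)
  refine ⟨PU, PV, ?_⟩
  let := PU.pretriangulated
  let := PT.pretriangulated
  let := PV.pretriangulated
  have hqi := commShift_equivariantAdjunction R.adj_qi S.q S.i S.unit_qi S.counit_qi
  have hip := commShift_equivariantAdjunction R.adj_ip S.i S.p S.unit_ip S.counit_ip
  have hle := commShift_equivariantAdjunction R.adj_le S.l S.e S.unit_le S.counit_le
  have her := commShift_equivariantAdjunction R.adj_er S.e S.r S.unit_er S.counit_er
  -- Exactness spreads from `q^G` to `i^G` and then to `p^G`, and from `e^G` to both of its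
  -- adjoints, by compatibility of the adjunctions with the shifts.
  have hi : S.i.equivariant.IsTriangulated :=
    (equivariantAdjunction S.q S.i R.adj_qi S.unit_qi S.counit_qi).isTriangulated_rightAdjoint
  have hp : S.p.equivariant.IsTriangulated :=
    (equivariantAdjunction S.i S.p R.adj_ip S.unit_ip S.counit_ip).isTriangulated_rightAdjoint
  have hl : S.l.equivariant.IsTriangulated :=
    (equivariantAdjunction S.l S.e R.adj_le S.unit_le S.counit_le).isTriangulated_leftAdjoint
  have hr : S.r.equivariant.IsTriangulated :=
    (equivariantAdjunction S.e S.r R.adj_er S.unit_er S.counit_er).isTriangulated_rightAdjoint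
  exact
    { isTriangulated_i := hi
      isTriangulated_q := hq
      isTriangulated_p := hp
      isTriangulated_e := he
      isTriangulated_l := hl
      isTriangulated_r := hr
      commShift_qi := hqi
      commShift_ip := hip
      commShift_le := hle
      commShift_er := her
      full_i := inferInstanceAs S.i.equivariant.Full
      faithful_i := inferInstanceAs S.i.equivariant.Faithful
      full_l := inferInstanceAs S.l.equivariant.Full
      faithful_l := inferInstanceAs S.l.equivariant.Faithful
      full_r := inferInstanceAs S.r.equivariant.Full
      faithful_r := inferInstanceAs S.r.equivariant.Faithful
      essImage_i_iff := hR.essImage_equivariant_iff S }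

end RecollementDiagram.IsRecollement

end Recollement

end

end EquivariantRecollement

/-! ### The main theorem -/

theorem mainTheorem3
    {U : Type u₁} [Category.{v₁} U] [HasZeroObject U] [HasShift U ℤ] [Preadditive U]
    [∀ n : ℤ, (shiftFunctor U n).Additive] [Pretriangulated U] [IsTriangulated U]
    {T : Type u₂} [Category.{v₂} T] [HasZeroObject T] [HasShift T ℤ] [Preadditive T]
    [∀ n : ℤ, (shiftFunctor T n).Additive] [Pretriangulated T] [IsTriangulated T]
    {V : Type u₃} [Category.{v₃} V] [HasZeroObject V] [HasShift V ℤ] [Preadditive V]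
    [∀ n : ℤ, (shiftFunctor V n).Additive] [Pretriangulated V] [IsTriangulated V]
    (R : RecollementDiagram U T V) (hR : R.IsRecollement)
    {G : Type w} [Group G] [Finite G] (AT : RightAction G T) [Admissible AT]
    (hG : CardInvertible G T) (PT : CanonicalTriangulation AT) :
    -- `G` acts admissibly on `V` with `e` a (triangulated) `G`-functor iff `U` is `G`-invariant;
    -- for (i) ⟹ (ii), a `G`-functor structure on `e` not related to the shifts suffices
    List.TFAE [
      ∃ (AV : RightAction G V) (_ : Admissible AV) (s : GFunctor AT AV R.e),
        IsTriangulatedGFunctor s,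
      ∃ (AV : RightAction G V) (_ : Admissible AV), Nonempty (GFunctor AT AV R.e),
      R.i.essImage.IsTriangulated ∧ IsGInvariant AT R.i.essImage] ∧
    -- in this case `U` inherits an admissible action for which `i` is a triangulated `G`-functor
    (IsGInvariant AT R.i.essImage →
      ∃ (AU : RightAction G U) (_ : Admissible AU) (s : GFunctor AU AT R.i),
        IsTriangulatedGFunctor s) ∧
    -- and for all such actions on `U` and `V`, `(U^G, T^G, V^G)` is a recollement
    (∀ (AU : RightAction G U) [Admissible AU] (AV : RightAction G V) [Admissible AV]
      (si : GFunctor AU AT R.i) (se : GFunctor AT AV R.e),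
      IsTriangulatedGFunctor si → IsTriangulatedGFunctor se →
      ∃ S : R.GStructure AU AT AV, S.i = si ∧ S.e = se ∧
        ∃ (PU : CanonicalTriangulation AU) (PV : CanonicalTriangulation AV),
          R.IsEquivariantRecollement S PU PT PV) := by
  have := hR.isTriangulated_i
  have := hR.full_i
  refine ⟨?_, hR.exists_action_left AT, fun AU _ AV _ si se _ _ => ?_⟩
  · tfae_have 1 → 2 := fun ⟨AV, hAV, s, _⟩ => ⟨AV, hAV, ⟨s⟩⟩
    -- That the essential image is a triangulated subcategory is automatic, since `i` is full and
    -- triangulated; only invariance uses the action on `V`.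
    tfae_have 2 → 3 := fun ⟨_, _, ⟨s⟩⟩ => ⟨inferInstance, hR.isGInvariant_of_gFunctor AT s⟩
    tfae_have 3 → 1 := fun h => hR.exists_action_right AT h.2
    tfae_finish
  · exact ⟨hR.gStructure si se, rfl, rfl, hR.exists_equivariant _ PT⟩
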